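/- **Setting.** Let $d\ge 1$, $M\ge 2$, let $\mathcal S=\{1,\dots,M\}^d\subset\mathbb R^d$ be the state space (so $|\mathcal S|=M^d$), and let $d_0,L$ be positive integers with $d_0L=M^d$ ($d_0$ is the transformer feature dimension, $L$ the number of tokens). *Transformers.* A transformer block with $h$ heads and hidden dimensions $s,r$ is $F^{\rm FF}\circ F^{\rm SA}:\mathbb R^{d_0\times L}\to\mathbb R^{d_0\times L}$, where $$F^{\rm SA}(Z)=Z+\sum_{i=1}^h W_O^i(W_V^iZ)\,\mathrm{Softmax}\big((W_K^iZ)^\top(W_Q^iZ)\big),\qquad F^{\rm FF}(Z)=Z+W_2\,\mathrm{ReLU}(W_1Z+b_1\mathbf 1_L^\top)+b_2\mathbf 1_L^\top,$$ with $W_K^i,W_Q^i,W_V^i,(W_O^i)^\top\in\mathbb R^{s\times d_0}$, $W_1,W_2^\top\in\mathbb R^{r\times d_0}$, $b_1\in\mathbb R^r$, $b_2\in\mathbb R^{d_0}$, and the softmax taken column-wise. Let $W_{KQ}^i=(W_K^i)^\top W_Q^i$ and $W_{OV}^i=W_O^iW_V^i$. The class $\mathcal T_R^{h,s,r}(C_{\mathcal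 T},C_{KQ}^{2,\infty},C_{KQ},C_{OV}^{2,\infty},C_{OV},C_E,C_F^{2,\infty},C_F,L_{\mathcal T})$ consists of the maps $R_2\circ f\circ F^{\rm E}\circ R_1:\mathbb R^{d+1}\to\mathbb R^{M^d}$, where - $R_1:\mathbb R^{d+1}\to\mathbb R^{d_0\times L}$ writes the entries of its argument column by column, repeated cyclically, into a $d_0\times L$ matrix (if $d_0\mid d+1\mid M^d$: the $d_0\times\frac{d+1}{d_0}$ matrix of the entries, replicated along the columns), and $R_2:\mathbb R^{d_0\times L}\to\mathbb R^{M^d}$ is the bijection that reads a matrix column by column; - $F^{\rm E}(Z)=Z+E$ with $\|E^\top\|_{2,\infty}\le C_E$, where $\|A\|_{2,\infty}$ is the largest $\ell_2$-norm of a row of $A$; - $f$ is a composition of one or more transformer blocks with $h$ heads and hidden dimensions $s,r$, in each of which $\|W_{KQ}^i\|_2\le C_{KQ}$, $\|W_{KQ}^i\|_{2,\infty}\le C_{KQ}^{2,\infty}$, $\|W_{OV}^i\|_2\le C_{OV}$, $\|W_{OV}^i\|_{2,\infty}\le C_{OV}^{2,\infty}$ for all $i$, and $\|W_j\|_2\le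 C_F$, $\|W_j\|_{2,\infty}\le C_F^{2,\infty}$ for $j=1,2$ ($\|\cdot\|_2$ being the spectral norm); - $\|f(Z)\|_F\le C_{\mathcal T}$ and $\|f(Z_1)-f(Z_2)\|_F\le L_{\mathcal T}\|Z_1-Z_2\|_F$ for all $Z,Z_1,Z_2\in\mathbb R^{d_0\times L}$. **Theorem (approximation theorem for discrete flow matching, general velocity).** Let $u:\mathcal S\times[0,1]\to\mathbb R^{M^d}$ be a (not necessarily factorized) velocity such that, for every $x\in\mathcal S$, $\|u(x,t)\|_2\le M_u$ for $t\in[0,1]$ and $t\mapsto u(x,t)$ is Lipschitz on $[0,1]$ in $\ell_2$-norm with constant $L_u$, and for each $t\in[0,1]$ let $p_t$ be a probability mass function on $\mathcal S$. Then for every $\epsilon>0$ with $\epsilon\le M^{d+1}M_u$ there are positive integers $h,s,r$ and a transformer network $u_\theta\in\mathcal T_R^{h,s,r}(C_{\mathcal T},C_{KQ}^{2,\infty},C_{KQ},C_{OV}^{2,\infty},C_{OV},C_E,C_F^{2,\infty},C_F,L_{\mathcal T})$ such that for every $t\in[0,1]$ $$\sum_{x\in\mathcal S}\|u_\theta(x,t)-u(x,t)\|_2^2\,p_t(x)\;\lesssim\;\epsilon^{\frac{4}{M^d+2}}\,M^{\frac{4M^ddd_0+13M^dd+8M^dd_0+12M^d}{M^d+2}}\,M_u^{\frac{8M^d}{M^d+2}},$$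 and the bounds on the parameters satisfy $$C_{KQ},C_{KQ}^{2,\infty}=\tilde O\big(M^{2dd_0+d+4d_0+2}\epsilon^{-4d_0-2}\big),\quad C_{OV},C_{OV}^{2,\infty}=O\big(M^{-\frac d2}\epsilon\big),\quad C_F,C_F^{2,\infty}=O\big(M^{d+1}M_u\epsilon^{-1}\big),\quad C_E=O(M^d).$$ Here $\lesssim$ hides a universal constant, $O(\cdot)$ hides a universal constant and a universal polynomial factor in $d,d_0$, $\tilde O(\cdot)$ hides moreover a universal power of $\log M$, and $C_{\mathcal T},L_{\mathcal T}$ are finite and depend only on $d,M,d_0,M_u,L_u$ (not on $\epsilon$). -/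

import Mathlib

open scoped Matrix

noncomputable section

namespace DFM

/-! ### Matrix norms -/

/-- Frobenius norm. -/
def frobNorm {m n : ℕ} (A : Matrix (Fin m) (Fin n) ℝ) : ℝ :=
  Real.sqrt (∑ i, ∑ j, A i j ^ 2)

/-- Spectral norm: the operator norm between Euclidean spaces. -/
def specNorm {m n : ℕ} (A : Matrix (Fin m) (Fin n) ℝ) : ℝ :=
  ‖LinearMap.toContinuousLinearMap (Matrix.toEuclideanLin A)‖

/-- The `(2,∞)`-norm: the largest Euclidean norm of a row. -/
def twoInftyNorm {m n : ℕ} (A : Matrix (Fin m) (Fin n) ℝ) : ℝ :=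
  ⨆ i, Real.sqrt (∑ j, A i j ^ 2)

/-! ### Transformer blocks -/

/-- Column-wise softmax. -/
def softmaxCols {m n : ℕ} (A : Matrix (Fin m) (Fin n) ℝ) : Matrix (Fin m) (Fin n) ℝ :=
  Matrix.of fun i j => Real.exp (A i j) / ∑ k, Real.exp (A k j)

/-- Parameters of one transformer block on `ℝ^{d₀ × L}` with `h` heads of hidden dimension `s`
and a feed-forward layer of hidden dimension `r`. -/
structure BlockParams (d₀ h s r : ℕ) where
  WK : Fin h → Matrix (Fin s) (Fin d₀) ℝ
  WQ : Fin h → Matrix (Fin s) (Fin d₀) ℝ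
  WV : Fin h → Matrix (Fin s) (Fin d₀) ℝ
  WO : Fin h → Matrix (Fin d₀) (Fin s) ℝ
  W₁ : Matrix (Fin r) (Fin d₀) ℝ
  W₂ : Matrix (Fin d₀) (Fin r) ℝ
  b₁ : Fin r → ℝ
  b₂ : Fin d₀ → ℝ

namespace BlockParams

variable {d₀ h s r : ℕ}

/-- `W_KQ^i = (W_K^i)ᵀ W_Q^i`. -/
def WKQ (P : BlockParams d₀ h s r) (i : Fin h) : Matrix (Fin d₀) (Fin d₀) ℝ :=
  (P.WK i)ᵀ * P.WQ i

/-- `W_OV^i = W_O^i W_V^i`. -/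
def WOV (P : BlockParams d₀ h s r) (i : Fin h) : Matrix (Fin d₀) (Fin d₀) ℝ :=
  P.WO i * P.WV i

/-- Multi-head self-attention with residual connection,
`Z + ∑ᵢ W_O^i (W_V^i Z) Softmax((W_K^i Z)ᵀ (W_Q^i Z))`. -/
def attention (P : BlockParams d₀ h s r) {L : ℕ} (Z : Matrix (Fin d₀) (Fin L) ℝ) :
    Matrix (Fin d₀) (Fin L) ℝ :=
  Z + ∑ i, P.WO i * (P.WV i * Z) * softmaxCols ((P.WK i * Z)ᵀ * (P.WQ i * Z))

/-- Feed-forward layer with residual connection,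
`Z + W₂ ReLU(W₁ Z + b₁ 𝟙ᵀ) + b₂ 𝟙ᵀ`. -/
def feedForward (P : BlockParams d₀ h s r) {L : ℕ} (Z : Matrix (Fin d₀) (Fin L) ℝ) :
    Matrix (Fin d₀) (Fin L) ℝ :=
  Z + P.W₂ * (Matrix.of fun i j => max ((P.W₁ * Z) i j + P.b₁ i) 0)
    + Matrix.of fun i _ => P.b₂ i

/-- The transformer block: feed-forward layer after self-attention layer. -/
def eval (P : BlockParams d₀ h s r) {L : ℕ} (Z : Matrix (Fin d₀) (Fin L) ℝ) :
    Matrix (Fin d₀) (Fin L) ℝ :=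
  P.feedForward (P.attention Z)

end BlockParams

/-- The composition of the blocks of a list; the last block of the list is applied first. -/
def evalBlocks {d₀ h s r L : ℕ} (B : List (BlockParams d₀ h s r))
    (Z : Matrix (Fin d₀) (Fin L) ℝ) : Matrix (Fin d₀) (Fin L) ℝ :=
  B.foldr (fun P Y => P.eval Y) Z

/-! ### Bounds on the parameters of a transformer -/

/-- The constants that bound the parameters of a transformer network class. -/
structure ParamBounds where
  /-- bound for the output -/
  CT : ℝ
  /-- bound for `‖W_KQ‖_{2,∞}` -/
  CKQ2inf : ℝ
  /-- bound for `‖W_KQ‖₂` -/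
  CKQ : ℝ
  /-- bound for `‖W_OV‖_{2,∞}` -/
  COV2inf : ℝ
  /-- bound for `‖W_OV‖₂` -/
  COV : ℝ
  /-- bound for `‖Eᵀ‖_{2,∞}` -/
  CE : ℝ
  /-- bound for `‖W₁‖_{2,∞}` and `‖W₂‖_{2,∞}` -/
  CF2inf : ℝ
  /-- bound for `‖W₁‖₂` and `‖W₂‖₂` -/
  CF : ℝ
  /-- bound for the Lipschitz constant with respect to the Frobenius norm -/
  LT : ℝ

/-- The weight matrices of a block obey the bounds `c`. -/
def BlockParams.Bounded {d₀ h s r : ℕ} (P : BlockParams d₀ h s r) (c : ParamBounds) : Prop :=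
  (∀ i, specNorm (P.WKQ i) ≤ c.CKQ ∧ twoInftyNorm (P.WKQ i) ≤ c.CKQ2inf ∧
      specNorm (P.WOV i) ≤ c.COV ∧ twoInftyNorm (P.WOV i) ≤ c.COV2inf) ∧
    specNorm P.W₁ ≤ c.CF ∧ specNorm P.W₂ ≤ c.CF ∧
    twoInftyNorm P.W₁ ≤ c.CF2inf ∧ twoInftyNorm P.W₂ ≤ c.CF2inf

/-! ### State space and reshape layers -/

/-- The state space `{1, …, M}^d`; the letter `j : Fin M` stands for the token `j + 1`. -/
abbrev State (d M : ℕ) : Type := Fin d → Fin M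

/-- The vector `(x, t) ∈ ℝ^{d+1}`, with the state `x` embedded in `ℝ^d` by the values `1, …, M`
of its tokens. -/
def stateTime {d M : ℕ} (x : State d M) (t : ℝ) : Fin (d + 1) → ℝ :=
  Fin.snoc (α := fun _ => ℝ) (fun i => ((x i : ℕ) : ℝ) + 1) t

/-- Input reshape layer: the entries of `v ∈ ℝ^{d+1}` are written, column by column and repeated
cyclically, into a `d₀ × L` matrix. If `d₀` divides `d + 1`, this places side by side copies of
the `d₀ × (d+1)/d₀` matrix that contains the entries of `v`. -/
def reshapeIn (d d₀ L : ℕ) (v : Fin (d + 1) → ℝ) : Matrix (Fin d₀) (Fin L) ℝ :=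
  Matrix.of fun i k => v (Fin.ofNat (d + 1) ((i : ℕ) + d₀ * (k : ℕ)))

/-- Output reshape layer: the bijection from `d₀ × L` matrices to vectors indexed by the `M^d`
states that reads the entries of the matrix column by column. -/
def reshapeOut {d M d₀ L : ℕ} (hL : L * d₀ = M ^ d) (Z : Matrix (Fin d₀) (Fin L) ℝ) :
    EuclideanSpace ℝ (State d M) :=
  WithLp.toLp 2 fun y =>
    let q : Fin L × Fin d₀ := finProdFinEquiv.symm (Fin.cast hL.symm (finFunctionFinEquiv y))
    Z q.2 q.1

/-- The class of transformer networks `R₂ ∘ f ∘ F^E ∘ R₁ : ℝ^{d+1} → ℝ^{M^d}`, where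
`F^E(Z) = Z + E` is the position encoding, `f` is a composition of at least one transformer block
with `h` heads and hidden dimensions `s`, `r`, and the parameters obey the bounds `c`. -/
def transformerClass {d M d₀ L : ℕ} (hL : L * d₀ = M ^ d) (h s r : ℕ) (c : ParamBounds) :
    Set ((Fin (d + 1) → ℝ) → EuclideanSpace ℝ (State d M)) :=
  {g | ∃ (B : List (BlockParams d₀ h s r)) (E : Matrix (Fin d₀) (Fin L) ℝ),
    B ≠ [] ∧ (∀ P ∈ B, P.Bounded c) ∧
    twoInftyNorm Eᵀ ≤ c.CE ∧
    (∀ Z : Matrix (Fin d₀) (Fin L) ℝ, frobNorm (evalBlocks B Z) ≤ c.CT) ∧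
    (∀ Z₁ Z₂ : Matrix (Fin d₀) (Fin L) ℝ,
      frobNorm (evalBlocks B Z₁ - evalBlocks B Z₂) ≤ c.LT * frobNorm (Z₁ - Z₂)) ∧
    ∀ v, g v = reshapeOut hL (evalBlocks B (reshapeIn d d₀ L v + E))}

end DFM

end

/-!
The depth of the network, the number of heads and the hidden width are not restricted, and this
makes the bounds on the single weights harmless; what has to be controlled is the Lipschitz constant
of the whole network, which may depend on the velocity only through `Mu` and `Lu`.

**Weights.** A power of two, realized by blocks `Z ↦ 2 Z`, scales the input up, and then small
weights realize any ReLU layer (`realizes_reluLayer`); Frobenius norms of order `√d₀` suffice, while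
`ε ≤ M ^ (d + 1) * Mu` allows a constant multiple of `d₀`. With zero key-query matrices the
attention is a plain average over the tokens, and its weight can be spread over so many heads that
each `W_OV` is as small as desired (`realizes_add_sum_tokens`).

**Encoding.** The position encoding shifts the entries of the input matrix so that each entry
reveals its position (`offset_separates`). One scalar function of the entries, summed over each
token, therefore produces the number of the token plus those digits of `(x, t)` that the token holds
(`exists_reluSum_tokenFeature`): the letters are digits in base `M`, the time is the fractional
part.
Once these scalars have been summed over all tokens, every token holds a scalar that determines the
token and the state and that moves with `t` at speed at least one
(`tokenCode_separates_tokens`, `tokenCode_separates_states`, `abs_sub_le_tokenCode`).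

**Decoding.** In terms of this scalar every entry of the velocity is a Lipschitz function with
constant `2 * Mu + |Lu|` (`abs_velocity_sub_le`), which extends to the line. Piecewise linear
interpolation, a shallow ReLU network, approximates it to any accuracy without increasing the
Lipschitz constant (`exists_reluSum_approx`). So the accuracy affects only the size of the
network, neither its bound nor its Lipschitz constant (`exists_pooledNet_approx`), and it can be
chosen to meet the required error.
-/

noncomputable section

namespace DFM

/-! ### Matrix norms are dominated by the Frobenius norm -/

lemma specNorm_le_frobNorm {m n : ℕ} (A : Matrix (Fin m) (Fin n) ℝ) :
    specNorm A ≤ frobNorm A := by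
  refine ContinuousLinearMap.opNorm_le_bound _ (Real.sqrt_nonneg _) fun v => ?_
  rw [LinearMap.coe_toContinuousLinearMap', EuclideanSpace.norm_eq, EuclideanSpace.norm_eq,
    frobNorm, ← Real.sqrt_mul (by positivity)]
  refine Real.sqrt_le_sqrt ?_
  rw [Finset.sum_mul]
  refine Finset.sum_le_sum fun i _ => ?_
  simp only [Matrix.toLpLin_apply, Matrix.mulVec, dotProduct, Real.norm_eq_abs, sq_abs]
  exact Finset.sum_mul_sq_le_sq_mul_sq _ _ _

lemma twoInftyNorm_le_frobNorm {m n : ℕ} (A : Matrix (Fin m) (Fin n) ℝ) :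
    twoInftyNorm A ≤ frobNorm A :=
  Real.iSup_le (fun i => Real.sqrt_le_sqrt <|
    Finset.single_le_sum (f := fun i => ∑ j, A i j ^ 2) (fun _ _ => by positivity)
      (Finset.mem_univ i)) (Real.sqrt_nonneg _)

lemma frobNorm_zero {m n : ℕ} : frobNorm (0 : Matrix (Fin m) (Fin n) ℝ) = 0 := by
  simp [frobNorm]

lemma frobNorm_le_of_forall_abs_le {m n : ℕ} {A : Matrix (Fin m) (Fin n) ℝ} {B : ℝ} (hB : 0 ≤ B)
    (h : ∀ i j, |A i j| ≤ B) : frobNorm A ≤ m * n * B := by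
  refine Real.sqrt_le_iff.2 ⟨by positivity, ?_⟩
  calc ∑ i, ∑ j, A i j ^ 2 ≤ ∑ _i : Fin m, ∑ _j : Fin n, B ^ 2 :=
        Finset.sum_le_sum fun i _ => Finset.sum_le_sum fun j _ => sq_le_sq' (by
          linarith [abs_le.1 (h i j)]) (abs_le.1 (h i j)).2
    _ = ((m * n : ℕ) : ℝ) * B ^ 2 := by simp; ring
    _ ≤ ((m * n : ℕ) : ℝ) ^ 2 * B ^ 2 := by
        gcongr
        exact_mod_cast Nat.le_self_pow two_ne_zero _
    _ = (m * n * B) ^ 2 := by push_cast; ring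

lemma abs_entry_le_frobNorm {m n : ℕ} (A : Matrix (Fin m) (Fin n) ℝ) (i : Fin m) (j : Fin n) :
    |A i j| ≤ frobNorm A := by
  refine Real.abs_le_sqrt ?_
  calc A i j ^ 2 ≤ ∑ j, A i j ^ 2 :=
        Finset.single_le_sum (f := fun j => A i j ^ 2) (fun _ _ => sq_nonneg _) (Finset.mem_univ j)
    _ ≤ _ := Finset.single_le_sum (f := fun i => ∑ j, A i j ^ 2) (fun _ _ => by positivity)
        (Finset.mem_univ i)

/-! ### Maps computed by bounded transformer blocks -/

/-- The bounds `c` admit every block whose key-query matrices vanish, whose matrices `W_OV` have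
Frobenius norm at most `ov`, and whose feed-forward matrices have Frobenius norm at most `ff`. -/
structure ParamBounds.Admits (c : ParamBounds) (ov ff : ℝ) : Prop where
  ov_nonneg : 0 ≤ ov
  ff_nonneg : 0 ≤ ff
  kq : 0 ≤ c.CKQ
  kq' : 0 ≤ c.CKQ2inf
  ov_le : ov ≤ c.COV
  ov_le' : ov ≤ c.COV2inf
  ff_le : ff ≤ c.CF
  ff_le' : ff ≤ c.CF2inf

/-- The map `f` is a composition of at least one transformer block with `h` heads, hidden
dimensions `s`, `r` and weights bounded by `c`. -/
def Realizes {d₀ L : ℕ} (c : ParamBounds) (h s r : ℕ)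
    (f : Matrix (Fin d₀) (Fin L) ℝ → Matrix (Fin d₀) (Fin L) ℝ) : Prop :=
  ∃ B : List (BlockParams d₀ h s r), B ≠ [] ∧ (∀ P ∈ B, P.Bounded c) ∧ ∀ Z, evalBlocks B Z = f Z

section Blocks

variable {d₀ L h s r : ℕ} {c : ParamBounds} {ov ff : ℝ}

lemma Realizes.comp {f g : Matrix (Fin d₀) (Fin L) ℝ → Matrix (Fin d₀) (Fin L) ℝ}
    (hf : Realizes c h s r f) (hg : Realizes c h s r g) : Realizes c h s r (f ∘ g) := by
  obtain ⟨B, hB, hBc, hBf⟩ := hf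
  obtain ⟨B', hB', hBc', hBg⟩ := hg
  refine ⟨B ++ B', by simp [hB], fun P hP => ?_, fun Z => ?_⟩
  · rcases List.mem_append.1 hP with h | h
    exacts [hBc P h, hBc' P h]
  · rw [evalBlocks, List.foldr_append]
    change evalBlocks B (evalBlocks B' Z) = _
    rw [hBg, hBf]
    rfl

lemma Realizes.of_block {f : Matrix (Fin d₀) (Fin L) ℝ → Matrix (Fin d₀) (Fin L) ℝ}
    (P : BlockParams d₀ h s r) (hP : P.Bounded c) (hf : ∀ Z, P.eval Z = f Z) :
    Realizes c h s r f :=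
  ⟨[P], by simp, by simpa using hP, fun Z => by simpa [evalBlocks] using hf Z⟩

/-- A ReLU network with one hidden layer, applied to each column of `Z`; its hidden units are
indexed by an arbitrary finite type. -/
def reluLayer {ι : Type*} [Fintype ι] (U₁ : ι → Fin d₀ → ℝ) (U₂ : Fin d₀ → ι → ℝ) (β₁ : ι → ℝ)
    (β₂ : Fin d₀ → ℝ) (Z : Matrix (Fin d₀) (Fin L) ℝ) : Matrix (Fin d₀) (Fin L) ℝ :=
  Matrix.of fun i k => ∑ j, U₂ i j * max (∑ i', U₁ j i' * Z i' k + β₁ j) 0 + β₂ i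

lemma realizes_add_reluLayer {ι : Type*} [Fintype ι] (hc : c.Admits ov ff)
    (hr : Fintype.card ι ≤ r) (U₁ : ι → Fin d₀ → ℝ) (U₂ : Fin d₀ → ι → ℝ) (β₁ : ι → ℝ)
    (β₂ : Fin d₀ → ℝ) (h₁ : ∑ j, ∑ i, U₁ j i ^ 2 ≤ ff ^ 2) (h₂ : ∑ i, ∑ j, U₂ i j ^ 2 ≤ ff ^ 2) :
    Realizes c h s r fun Z : Matrix (Fin d₀) (Fin L) ℝ => Z + reluLayer U₁ U₂ β₁ β₂ Z := by
  obtain ⟨e⟩ : Nonempty (ι ↪ Fin r) :=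
    Function.Embedding.nonempty_of_card_le (by simpa using hr)
  -- The hidden units outside the range of `e` receive zero weights.
  let P : BlockParams d₀ h s r :=
    { WK := 0, WQ := 0, WV := 0, WO := 0
      W₁ := Matrix.of (Function.extend e U₁ 0)
      W₂ := Matrix.of fun i => Function.extend e (U₂ i) 0
      b₁ := Function.extend e β₁ 0
      b₂ := β₂ }
  have f₁ : frobNorm P.W₁ ≤ ff := by
    refine Real.sqrt_le_iff.2 ⟨hc.ff_nonneg, le_trans (le_of_eq ?_) h₁⟩
    refine (Fintype.sum_of_injective e e.injective _ _ (fun j hj => ?_) fun j => ?_).symm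
    · simp [P, Function.extend_apply' _ _ _ (by simpa using hj)]
    · simp [P, e.injective.extend_apply]
  have f₂ : frobNorm P.W₂ ≤ ff := by
    refine Real.sqrt_le_iff.2 ⟨hc.ff_nonneg, le_trans (le_of_eq ?_) h₂⟩
    refine Finset.sum_congr rfl fun i _ => ?_
    refine (Fintype.sum_of_injective e e.injective _ _ (fun j hj => ?_) fun j => ?_).symm
    · simp [P, Function.extend_apply' _ _ _ (by simpa using hj)]
    · simp [P, e.injective.extend_apply]
  refine Realizes.of_block P ⟨fun i => ?_, ?_, ?_, ?_, ?_⟩ fun Z => ?_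
  · have hKQ : P.WKQ i = 0 := by simp [P, BlockParams.WKQ]
    have hOV : P.WOV i = 0 := by simp [P, BlockParams.WOV]
    have hov := hc.ov_nonneg
    rw [hKQ, hOV]
    refine ⟨(specNorm_le_frobNorm _).trans ?_, (twoInftyNorm_le_frobNorm _).trans ?_,
      (specNorm_le_frobNorm _).trans ?_, (twoInftyNorm_le_frobNorm _).trans ?_⟩ <;>
      rw [frobNorm_zero]
    exacts [hc.kq, hc.kq', hov.trans hc.ov_le, hov.trans hc.ov_le']
  · exact (specNorm_le_frobNorm _).trans (f₁.trans hc.ff_le)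
  · exact (specNorm_le_frobNorm _).trans (f₂.trans hc.ff_le)
  · exact (twoInftyNorm_le_frobNorm _).trans (f₁.trans hc.ff_le')
  · exact (twoInftyNorm_le_frobNorm _).trans (f₂.trans hc.ff_le')
  · have hatt : P.attention Z = Z := by simp [P, BlockParams.attention]
    rw [BlockParams.eval, hatt, BlockParams.feedForward, add_assoc]
    congr 1
    ext i k
    simp only [reluLayer, Matrix.add_apply, Matrix.of_apply, Matrix.mul_apply]
    congr 1
    refine (Fintype.sum_of_injective e e.injective _ _ (fun j hj => ?_) fun j => ?_).symm
    · simp [P, Function.extend_apply' _ _ _ (by simpa using hj)]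
    · simp [P, e.injective.extend_apply]

/-- The identity is the hidden-layer map `z ↦ relu z - relu (-z)`, and so every linear scaling is
available to residual layers. -/
lemma realizes_two_smul (hc : c.Admits ov ff) (hr : 2 * d₀ ≤ r) (hff : 2 * (d₀ : ℝ) ≤ ff ^ 2) :
    Realizes c h s r fun Z : Matrix (Fin d₀) (Fin L) ℝ => (2 : ℝ) • Z := by
  have key := realizes_add_reluLayer (L := L) (h := h) (s := s) (r := r) (ι := Fin d₀ ⊕ Fin d₀)
    hc (by simpa [two_mul] using hr)
    (Sum.elim (fun j i => if j = i then 1 else 0) fun j i => if j = i then -1 else 0)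
    (fun i => Sum.elim (fun j => if i = j then 1 else 0) fun j => if i = j then -1 else 0) 0 0
    (by simpa [two_mul] using hff) (by simpa [two_mul, Finset.sum_add_distrib] using hff)
  convert key using 2 with Z
  ext i k
  rcases le_total 0 (Z i k) with hz | hz <;>
    simp [reluLayer, two_mul, hz]

lemma realizes_two_pow_smul (hc : c.Admits ov ff) (hr : 2 * d₀ ≤ r)
    (hff : 2 * (d₀ : ℝ) ≤ ff ^ 2) (n : ℕ) :
    Realizes c h s r fun Z : Matrix (Fin d₀) (Fin L) ℝ => (2 : ℝ) ^ (n + 1) • Z := by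
  induction n with
  | zero => simpa using realizes_two_smul hc hr hff
  | succ n ih =>
    convert (realizes_two_smul hc hr hff).comp ih using 2 with Z
    simp only [Function.comp, smul_smul]
    rw [pow_succ' _ (n + 1)]

/-- Depth removes the bound on the feed-forward weights: once the input has been scaled up by a
power of two, first-layer weights smaller by that factor suffice, the homogeneity of the ReLU
balances the two layers, and two further units per coordinate cancel the residual connection. -/
lemma realizes_reluLayer {ι : Type*} [Fintype ι] (hc : c.Admits ov ff)
    (hr : Fintype.card ι + 2 * d₀ ≤ r) (hff : 2 * (d₀ : ℝ) + 1 ≤ ff ^ 2) (U₁ : ι → Fin d₀ → ℝ)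
    (U₂ : Fin d₀ → ι → ℝ) (β₁ : ι → ℝ) (β₂ : Fin d₀ → ℝ) :
    Realizes c h s r fun Z : Matrix (Fin d₀) (Fin L) ℝ => reluLayer U₁ U₂ β₁ β₂ Z := by
  set S₁ := ∑ j, ∑ i, U₁ j i ^ 2 with hS₁
  set S₂ := ∑ i, ∑ j, U₂ i j ^ 2 with hS₂
  have hS₁0 : 0 ≤ S₁ := by positivity
  have hS₂0 : 0 ≤ S₂ := by positivity
  -- `μ` balances the layers and `q` is the scale of the input.
  set μ := S₂ + 1 with hμ
  have hμ0 : 0 < μ := by positivity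
  have hμ2 : S₂ / μ ^ 2 ≤ 1 := by
    rw [div_le_one (by positivity)]
    nlinarith
  obtain ⟨n, hn⟩ := pow_unbounded_of_one_lt (μ ^ 2 * S₁ + 1) (one_lt_two (α := ℝ))
  set q : ℝ := 2 ^ (n + 1) with hq
  have hq0 : 0 < q := by positivity
  have hqn : μ ^ 2 * S₁ + 1 ≤ q := hn.le.trans (pow_le_pow_right₀ one_le_two n.le_succ)
  have hq2 : (μ / q) ^ 2 * S₁ ≤ 1 := by
    rw [div_pow, div_mul_eq_mul_div, div_le_one (by positivity)]
    have : 0 ≤ μ ^ 2 * S₁ := by positivity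
    nlinarith
  have key := realizes_add_reluLayer (L := L) (h := h) (s := s) (r := r)
    (ι := ι ⊕ (Fin d₀ ⊕ Fin d₀)) hc (by simpa [two_mul] using hr)
    (Sum.elim (fun j i => μ / q * U₁ j i)
      (Sum.elim (fun j i => if j = i then 1 else 0) fun j i => if j = i then -1 else 0))
    (fun i => Sum.elim (fun j => U₂ i j / μ)
      (Sum.elim (fun j => if i = j then -1 else 0) fun j => if i = j then 1 else 0))
    (Sum.elim (fun j => μ * β₁ j) 0) β₂
    (by
      refine le_trans ?_ hff
      simp only [Fintype.sum_sum_type, Sum.elim_inl, Sum.elim_inr, mul_pow, ← Finset.mul_sum,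
        ← hS₁]
      simp
      linarith)
    (by
      refine le_trans ?_ hff
      simp only [Fintype.sum_sum_type, Sum.elim_inl, Sum.elim_inr, div_pow, ← Finset.sum_div,
        Finset.sum_add_distrib, ← hS₂]
      simp
      linarith)
  convert key.comp (realizes_two_pow_smul hc (by omega) (by linarith) n) using 2 with Z
  ext i k
  have hterm : ∀ j, U₂ i j / μ * max (∑ i', μ / q * U₁ j i' * (q * Z i' k) + μ * β₁ j) 0
      = U₂ i j * max (∑ i', U₁ j i' * Z i' k + β₁ j) 0 := by
    intro j
    have : ∑ i', μ / q * U₁ j i' * (q * Z i' k) + μ * β₁ j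
        = μ * (∑ i', U₁ j i' * Z i' k + β₁ j) := by
      rw [mul_add, Finset.mul_sum]
      congr 1
      refine Finset.sum_congr rfl fun i' _ => ?_
      field_simp
    rw [this, ← mul_zero μ, ← mul_max_of_nonneg _ _ hμ0.le, mul_zero]
    field_simp
  simp only [Function.comp, reluLayer, Matrix.add_apply, Matrix.of_apply, Matrix.smul_apply,
    smul_eq_mul, Fintype.sum_sum_type, Sum.elim_inl, Sum.elim_inr, ← hq, hterm]
  rcases le_total 0 (q * Z i k) with hz | hz <;> simp [hz] <;> ring

lemma softmaxCols_zero {m n : ℕ} :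
    softmaxCols (0 : Matrix (Fin m) (Fin n) ℝ) = Matrix.of fun _ _ => (m : ℝ)⁻¹ := by
  ext i j
  simp [softmaxCols]

/-- With vanishing key-query matrices the attention averages the tokens. The weight of the average
is spread evenly over the heads, and so each `W_OV` is small once there are many of them. -/
lemma realizes_add_sum_tokens (hc : c.Admits ov ff) (hL : 0 < L) (hh : 0 < h) {α : ℝ} (hα : 0 ≤ α)
    (hα' : α * L * d₀ ≤ h * ov) :
    Realizes c h d₀ r fun Z : Matrix (Fin d₀) (Fin L) ℝ =>
      Matrix.of fun i k => Z i k + α * ∑ j, Z i j := by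
  have hh' : (0 : ℝ) < h := by exact_mod_cast hh
  have hL' : (L : ℝ) ≠ 0 := by exact_mod_cast hL.ne'
  let P : BlockParams d₀ h d₀ r :=
    { WK := 0, WQ := 0, WV := fun _ => 1, WO := fun _ => (α * L / h) • 1
      W₁ := 0, W₂ := 0, b₁ := 0, b₂ := 0 }
  have hff := hc.ff_nonneg
  have hOV : frobNorm ((α * L / h) • (1 : Matrix (Fin d₀) (Fin d₀) ℝ)) ≤ ov := by
    refine le_trans (Real.sqrt_le_iff.2 ⟨by positivity, ?_⟩) ((div_le_iff₀' hh').2 hα')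
    simp only [Matrix.smul_apply, Matrix.one_apply, smul_eq_mul, mul_ite, mul_one, mul_zero,
      ite_pow, ne_eq, OfNat.ofNat_ne_zero, not_false_eq_true, zero_pow, Finset.sum_ite_eq,
      Finset.mem_univ, if_true, Finset.sum_const, Finset.card_univ, Fintype.card_fin, nsmul_eq_mul]
    have : (d₀ : ℝ) ≤ (d₀ : ℝ) ^ 2 := by exact_mod_cast Nat.le_self_pow two_ne_zero _
    calc (d₀ : ℝ) * (α * L / h) ^ 2 ≤ (d₀ : ℝ) ^ 2 * (α * L / h) ^ 2 := by gcongr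
      _ = _ := by ring
  refine Realizes.of_block P ⟨fun i => ?_, ?_, ?_, ?_, ?_⟩ fun Z => ?_
  · have hKQ : P.WKQ i = 0 := by simp [P, BlockParams.WKQ]
    have hOV' : P.WOV i = (α * L / h) • 1 := by simp [P, BlockParams.WOV]
    rw [hKQ, hOV']
    refine ⟨(specNorm_le_frobNorm _).trans (frobNorm_zero.trans_le hc.kq),
      (twoInftyNorm_le_frobNorm _).trans (frobNorm_zero.trans_le hc.kq'),
      (specNorm_le_frobNorm _).trans (hOV.trans hc.ov_le),
      (twoInftyNorm_le_frobNorm _).trans (hOV.trans hc.ov_le')⟩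
  · exact (specNorm_le_frobNorm _).trans (frobNorm_zero.trans_le (hff.trans hc.ff_le))
  · exact (specNorm_le_frobNorm _).trans (frobNorm_zero.trans_le (hff.trans hc.ff_le))
  · exact (twoInftyNorm_le_frobNorm _).trans (frobNorm_zero.trans_le (hff.trans hc.ff_le'))
  · exact (twoInftyNorm_le_frobNorm _).trans (frobNorm_zero.trans_le (hff.trans hc.ff_le'))
  · have hff : ∀ Y : Matrix (Fin d₀) (Fin L) ℝ, P.feedForward Y = Y := fun Y => by
      ext i k
      simp [P, BlockParams.feedForward]
    rw [BlockParams.eval, hff]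
    ext i k
    simp only [BlockParams.attention, P, Pi.zero_apply, Matrix.zero_mul, Matrix.transpose_zero,
      softmaxCols_zero, Matrix.one_mul, Matrix.smul_mul, Finset.sum_const, Finset.card_univ,
      Fintype.card_fin, Matrix.add_apply, Matrix.smul_apply, Matrix.of_apply, Matrix.mul_apply,
      ← Finset.sum_mul, smul_eq_mul, nsmul_eq_mul]
    field_simp

end Blocks

/-! ### Shallow ReLU approximation of Lipschitz functions -/

/-- A scalar ReLU network with one hidden layer and unit inner weights. -/
def reluSum {ι : Type*} [Fintype ι] (a b : ι → ℝ) (c₀ y : ℝ) : ℝ := ∑ j, a j * max (y + b j) 0 + c₀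

lemma exists_lipschitz_extension {ι : Type*} (p τ : ι → ℝ) {K : ℝ} (hK : 0 ≤ K)
    (h : ∀ a b, |τ a - τ b| ≤ K * |p a - p b|) :
    ∃ G : ℝ → ℝ, (∀ x y, |G x - G y| ≤ K * |x - y|) ∧ ∀ a, G (p a) = τ a := by
  rcases isEmpty_or_nonempty ι with hι | hι
  · exact ⟨fun _ => 0, fun x y => by simpa using by positivity, fun a => (hι.false a).elim⟩
  have hinv : ∀ a, τ (Function.invFun p (p a)) = τ a := fun a => by
    have := h (Function.invFun p (p a)) a
    rw [Function.invFun_eq (f := p) ⟨a, rfl⟩, sub_self, abs_zero, mul_zero] at this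
    exact sub_eq_zero.1 (abs_nonpos_iff.1 this)
  have hlip : LipschitzOnWith K.toNNReal (τ ∘ Function.invFun p) (Set.range p) := by
    refine LipschitzOnWith.of_dist_le_mul ?_
    rintro _ ⟨a, rfl⟩ _ ⟨b, rfl⟩
    simpa [Real.dist_eq, hinv, hK] using h a b
  obtain ⟨G, hG, hGe⟩ := hlip.extend_real
  refine ⟨G, fun x y => ?_, fun a => ?_⟩
  · simpa [Real.dist_eq, hK] using hG.dist_le_mul x y
  · rw [← hGe ⟨a, rfl⟩, Function.comp, hinv]

/-- The difference of two consecutive hinges, a ramp that rises from `0` at `x₀ + n η` to `η` at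
`x₀ + (n + 1) η`. -/
def ramp (x₀ η : ℝ) (n : ℕ) (y : ℝ) : ℝ :=
  max (y - (x₀ + n * η)) 0 - max (y - (x₀ + (n + 1 : ℕ) * η)) 0

lemma ramp_mono {x₀ η : ℝ} (hη : 0 ≤ η) (n : ℕ) : Monotone (ramp x₀ η n) := by
  intro y y' h
  unfold ramp
  push_cast
  rcases max_cases (y - (x₀ + n * η)) 0 with h1 | h1 <;>
  rcases max_cases (y - (x₀ + (n + 1) * η)) 0 with h2 | h2 <;>
  rcases max_cases (y' - (x₀ + n * η)) 0 with h3 | h3 <;>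
  rcases max_cases (y' - (x₀ + (n + 1) * η)) 0 with h4 | h4 <;>
  linarith

lemma sum_ramp (x₀ η : ℝ) (N : ℕ) (y : ℝ) :
    ∑ n ∈ Finset.range N, ramp x₀ η n y = max (y - x₀) 0 - max (y - (x₀ + N * η)) 0 := by
  simp only [ramp]
  rw [Finset.sum_range_sub' (fun n : ℕ => max (y - (x₀ + n * η)) 0)]
  simp

lemma ramp_grid {x₀ η : ℝ} (hη : 0 ≤ η) (n m : ℕ) :
    ramp x₀ η n (x₀ + m * η) = if n < m then η else 0 := by
  unfold ramp
  split_ifs with h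
  · have h' : ((n : ℝ) + 1) ≤ m := by exact_mod_cast h
    have := mul_le_mul_of_nonneg_right h' hη
    push_cast
    rw [max_eq_left (by nlinarith), max_eq_left (by linarith)]
    ring
  · have h' : (m : ℝ) ≤ n := by exact_mod_cast not_lt.1 h
    have := mul_le_mul_of_nonneg_right h' hη
    push_cast
    rw [max_eq_right (by linarith), max_eq_right (by linarith)]
    ring

/-- Piecewise linear interpolation on a fine grid approximates a Lipschitz function on an interval
by a scalar ReLU network, without increasing the Lipschitz constant. -/
lemma exists_reluSum_approx {G : ℝ → ℝ} {K : ℝ} (hG : ∀ x y, |G x - G y| ≤ K * |x - y|)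
    {R δ : ℝ} (hR : 0 < R) (hδ : 0 < δ) :
    ∃ (ι : Type) (_ : Fintype ι) (a b : ι → ℝ) (c₀ : ℝ),
      (∀ x y, |reluSum a b c₀ x - reluSum a b c₀ y| ≤ K * |x - y|) ∧
      (∀ y, |reluSum a b c₀ y| ≤ |G (-R)| + K * (2 * R)) ∧
      ∀ y, |y| ≤ R → |reluSum a b c₀ y - G y| ≤ δ := by
  have hK : 0 ≤ K := by simpa using (abs_nonneg _).trans (hG 1 0)
  obtain ⟨N, hN⟩ := exists_nat_gt (4 * K * R / δ)
  have hN0 : (0 : ℝ) < N := lt_of_le_of_lt (by positivity) hN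
  set η : ℝ := 2 * R / N with hη
  have hη0 : 0 < η := by positivity
  have hNη : N * η = 2 * R := by rw [hη]; field_simp
  have hKη : 2 * K * η ≤ δ := by
    rw [div_lt_iff₀ hδ] at hN
    rw [hη, ← mul_div_assoc, div_le_iff₀ hN0]
    linarith
  let x : ℕ → ℝ := fun n => -R + n * η
  let σ : ℕ → ℝ := fun n => (G (x (n + 1)) - G (x n)) / η
  have hσ : ∀ n, |σ n| ≤ K := fun n => by
    rw [abs_div, abs_of_pos hη0, div_le_iff₀ hη0]
    refine (hG _ _).trans (le_of_eq ?_)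
    have : x (n + 1) - x n = η := by simp only [x]; push_cast; ring
    rw [this, abs_of_pos hη0]
  let g : ℝ → ℝ := fun y => ∑ n ∈ Finset.range N, σ n * ramp (-R) η n y + G (-R)
  obtain ⟨a, b, hg⟩ : ∃ a b : Fin N ⊕ Fin N → ℝ, ∀ y, reluSum a b (G (-R)) y = g y := by
    refine ⟨Sum.elim (fun n => σ n) fun n => -σ n, Sum.elim (fun n => -(-R + (n : ℕ) * η))
      fun n => -(-R + ((n : ℕ) + 1 : ℕ) * η), fun y => ?_⟩
    simp only [reluSum, Fintype.sum_sum_type, Sum.elim_inl, Sum.elim_inr, g, ramp,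
      ← Finset.sum_add_distrib]
    rw [Finset.sum_range]
    congr 1
    refine Finset.sum_congr rfl fun n _ => ?_
    ring_nf
  have hmono : ∀ y y', y ≤ y' → |g y' - g y| ≤ K * (y' - y) := fun y y' h => by
    have hr := fun n => sub_nonneg.2 (ramp_mono (x₀ := -R) hη0.le n h)
    calc |g y' - g y| = |∑ n ∈ Finset.range N, σ n * (ramp (-R) η n y' - ramp (-R) η n y)| := by
          simp only [g, mul_sub, Finset.sum_sub_distrib]
          ring_nf
      _ ≤ ∑ n ∈ Finset.range N, |σ n * (ramp (-R) η n y' - ramp (-R) η n y)| :=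
          Finset.abs_sum_le_sum_abs _ _
      _ ≤ ∑ n ∈ Finset.range N, K * (ramp (-R) η n y' - ramp (-R) η n y) := by
          refine Finset.sum_le_sum fun n _ => ?_
          rw [abs_mul, abs_of_nonneg (hr n)]
          exact mul_le_mul_of_nonneg_right (hσ n) (hr n)
      _ ≤ K * (y' - y) := by
          rw [← Finset.mul_sum, Finset.sum_sub_distrib, sum_ramp, sum_ramp]
          refine mul_le_mul_of_nonneg_left ?_ hK
          rcases max_cases (y - -R) 0 with h1 | h1 <;>
          rcases max_cases (y - (-R + N * η)) 0 with h2 | h2 <;>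
          rcases max_cases (y' - -R) 0 with h3 | h3 <;>
          rcases max_cases (y' - (-R + N * η)) 0 with h4 | h4 <;>
          linarith
  have hlip : ∀ y y', |g y - g y'| ≤ K * |y - y'| := fun y y' => by
    rcases le_total y y' with h | h
    · rw [abs_sub_comm, abs_sub_comm y, abs_of_nonneg (sub_nonneg.2 h)]
      exact hmono y y' h
    · rw [abs_of_nonneg (sub_nonneg.2 h)]
      exact hmono y' y h
  have hgrid : ∀ m ≤ N, g (x m) = G (x m) := fun m hm => by
    have h1 : ∀ n, σ n * ramp (-R) η n (x m)
        = if n < m then G (x (n + 1)) - G (x n) else 0 := fun n => by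
      simp only [x, ramp_grid hη0.le, mul_ite, mul_zero]
      congr 1
      simp only [σ, x]
      field_simp
    have h2 : (Finset.range N).filter (· < m) = Finset.range m := by
      ext n
      simp
      omega
    simp only [g, h1]
    rw [← Finset.sum_filter, h2, Finset.sum_range_sub fun n => G (x n)]
    simp [x]
  refine ⟨Fin N ⊕ Fin N, inferInstance, a, b, G (-R), fun y y' => ?_, fun y => ?_, fun y hy => ?_⟩
  · rw [hg, hg]
    exact hlip y y'
  · rw [hg]
    have hr0 : ∀ n, 0 ≤ ramp (-R) η n y := fun n => by
      have h1 := ramp_mono (x₀ := -R) hη0.le n (min_le_right (-R) y)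
      have h2 : ramp (-R) η n (min (-R) y) = 0 := by
        have h3 : min (-R) y ≤ -R := min_le_left _ _
        have h4 : (0 : ℝ) ≤ n * η := by positivity
        simp only [ramp]
        push_cast
        rw [max_eq_right (by linarith), max_eq_right (by linarith), sub_zero]
      rwa [h2] at h1
    calc |g y| ≤ |∑ n ∈ Finset.range N, σ n * ramp (-R) η n y| + |G (-R)| := abs_add_le _ _
      _ ≤ ∑ n ∈ Finset.range N, K * ramp (-R) η n y + |G (-R)| := by
          gcongr
          refine (Finset.abs_sum_le_sum_abs _ _).trans (Finset.sum_le_sum fun n _ => ?_)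
          rw [abs_mul, abs_of_nonneg (hr0 n)]
          exact mul_le_mul_of_nonneg_right (hσ n) (hr0 n)
      _ ≤ |G (-R)| + K * (2 * R) := by
          rw [← Finset.mul_sum, sum_ramp, add_comm]
          gcongr
          rcases max_cases (y - -R) 0 with h1 | h1 <;>
          rcases max_cases (y - (-R + N * η)) 0 with h2 | h2 <;>
          linarith
  · rw [hg]
    have hy' := abs_le.1 hy
    have hq0 : 0 ≤ (y + R) / η := div_nonneg (by linarith) hη0.le
    set m := ⌊(y + R) / η⌋₊ with hm
    have hm1 : (m : ℝ) * η ≤ y + R := (le_div_iff₀ hη0).1 (Nat.floor_le hq0)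
    have hm2 : y + R < (m + 1) * η := (div_lt_iff₀ hη0).1 (Nat.lt_floor_add_one _)
    have hmN : m ≤ N := by
      have : (m : ℝ) * η ≤ N * η := by linarith
      exact_mod_cast le_of_mul_le_mul_right this hη0
    have hd : |y - x m| ≤ η := abs_le.2 ⟨by simp only [x]; linarith, by simp only [x]; linarith⟩
    have hd' := mul_le_mul_of_nonneg_left hd hK
    calc |g y - G y| = |(g y - g (x m)) + (G (x m) - G y)| := by rw [hgrid m hmN]; ring_nf
      _ ≤ |g y - g (x m)| + |G (x m) - G y| := abs_add_le _ _
      _ ≤ K * |y - x m| + K * |y - x m| :=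
          add_le_add (hlip _ _) ((hG _ _).trans_eq (by rw [abs_sub_comm]))
      _ ≤ δ := by linarith

/-- Lipschitz data `p a ↦ τ a` are fitted up to `δ` by a scalar ReLU network whose Lipschitz
constant and bound do not depend on `δ`. -/
lemma exists_reluSum_fit {ι : Type*} [Nonempty ι] (p τ : ι → ℝ) {K R B δ : ℝ} (hK : 0 ≤ K)
    (h : ∀ a b, |τ a - τ b| ≤ K * |p a - p b|) (hR : 0 < R) (hp : ∀ a, |p a| ≤ R)
    (hτ : ∀ a, |τ a| ≤ B) (hδ : 0 < δ) :
    ∃ (κ : Type) (_ : Fintype κ) (a b : κ → ℝ) (c₀ : ℝ),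
      (∀ x y, |reluSum a b c₀ x - reluSum a b c₀ y| ≤ K * |x - y|) ∧
      (∀ y, |reluSum a b c₀ y| ≤ B + K * (4 * R)) ∧
      ∀ i, |reluSum a b c₀ (p i) - τ i| ≤ δ := by
  obtain ⟨G, hG, hGp⟩ := exists_lipschitz_extension p τ hK h
  obtain ⟨κ, hκ, a, b, c₀, h1, h2, h3⟩ := exists_reluSum_approx hG hR hδ
  refine ⟨κ, hκ, a, b, c₀, h1, fun y => (h2 y).trans ?_, fun i => hGp i ▸ h3 _ (hp i)⟩
  obtain ⟨i⟩ := ‹Nonempty ι›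
  have h4 := hG (-R) (p i)
  have h5 : |-R - p i| ≤ 2 * R := by
    have := abs_le.1 (hp i)
    exact abs_le.2 ⟨by linarith, by linarith⟩
  have h6 := mul_le_mul_of_nonneg_left h5 hK
  have h7 : |G (-R)| ≤ |G (-R) - G (p i)| + |G (p i)| := by
    simpa using abs_add_le (G (-R) - G (p i)) (G (p i))
  rw [hGp] at h7 h4
  linarith [hτ i]

/-! ### Scalar codes of tokens, states and times -/

variable {d M : ℕ}

lemma stateTime_ofNat_of_lt {m : ℕ} (h : m % (d + 1) < d) (x : State d M) (t : ℝ) :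
    stateTime x t (Fin.ofNat (d + 1) m) = ((x ⟨m % (d + 1), h⟩ : ℕ) : ℝ) + 1 := by
  have : Fin.ofNat (d + 1) m = Fin.castSucc ⟨m % (d + 1), h⟩ := rfl
  rw [this, stateTime, Fin.snoc_castSucc]

lemma stateTime_ofNat_of_not_lt {m : ℕ} (h : ¬ m % (d + 1) < d) (x : State d M) (t : ℝ) :
    stateTime x t (Fin.ofNat (d + 1) m) = t := by
  have : Fin.ofNat (d + 1) m = Fin.last d :=
    Fin.ext (le_antisymm (Nat.lt_succ_iff.1 (Nat.mod_lt _ d.succ_pos)) (not_lt.1 h))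
  rw [this, stateTime, Fin.snoc_last]

lemma stateTime_mem_Icc (hM : 2 ≤ M) (x : State d M) {t : ℝ} (ht : t ∈ Set.Icc (0 : ℝ) 1) (m : ℕ) :
    stateTime x t (Fin.ofNat (d + 1) m) ∈ Set.Icc (0 : ℝ) M := by
  by_cases h : m % (d + 1) < d
  · rw [stateTime_ofNat_of_lt h]
    have : ((x ⟨m % (d + 1), h⟩ : ℕ) : ℝ) + 1 ≤ M := by
      exact_mod_cast (x ⟨m % (d + 1), h⟩).isLt
    exact ⟨by positivity, this⟩
  · rw [stateTime_ofNat_of_not_lt h]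
    have : (2 : ℝ) ≤ M := by exact_mod_cast hM
    exact ⟨ht.1, by linarith [ht.2]⟩

/-- Position offset of the `m`-th of the `N` matrix entries. An entry that holds a letter is an
integer, so that a fractional shift below `1/2` reveals its position; the entries that hold the
time are moved to disjoint unit intervals beyond all letters. -/
def offset (d M N m : ℕ) : ℝ :=
  if m % (d + 1) < d then m / (2 * N) else M + 2 + 2 * m

lemma offset_nonneg (d M N m : ℕ) : 0 ≤ offset d M N m := by
  unfold offset
  split_ifs <;> positivity

lemma offset_le {N m : ℕ} (hm : m < N) : offset d M N m ≤ M + 2 + 2 * N := by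
  have hm' : (m : ℝ) ≤ N := by exact_mod_cast hm.le
  have hN : (1 : ℝ) ≤ N := by exact_mod_cast (Nat.zero_le m).trans_lt hm
  have hM : (0 : ℝ) ≤ M := M.cast_nonneg
  unfold offset
  split_ifs
  · have : (m : ℝ) / (2 * N) ≤ 1 := by
      rw [div_le_one (by linarith)]
      linarith
    linarith
  · linarith

lemma one_le_abs_of_int_ne_zero {n : ℤ} (hn : n ≠ 0) : (1 : ℝ) ≤ |(n : ℝ)| := by
  exact_mod_cast Int.one_le_abs hn

/-- The shifted entries at different positions are separated, whatever state and time they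
come from. -/
lemma offset_separates {N m m' : ℕ} (hm : m < N) (hm' : m' < N) (hne : m ≠ m')
    (x x' : State d M) {t t' : ℝ} (ht : t ∈ Set.Icc (0 : ℝ) 1) (ht' : t' ∈ Set.Icc (0 : ℝ) 1) :
    1 / (2 * N) ≤ |stateTime x t (Fin.ofNat (d + 1) m) + offset d M N m -
      (stateTime x' t' (Fin.ofNat (d + 1) m') + offset d M N m')| := by
  have hN : (1 : ℝ) ≤ N := by exact_mod_cast (Nat.zero_le m).trans_lt hm
  have hN2 : 1 / (2 * (N : ℝ)) ≤ 1 / 2 := by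
    rw [div_le_div_iff₀ (by linarith) two_pos]
    linarith
  have hfrac : ∀ n < N, (n : ℝ) / (2 * N) < 1 / 2 := fun n hn => by
    rw [div_lt_div_iff₀ (by linarith) two_pos]
    have : (n : ℝ) < N := by exact_mod_cast hn
    linarith
  have hfrac0 : ∀ n : ℕ, 0 ≤ (n : ℝ) / (2 * N) := fun n => by positivity
  have hlet : ∀ (y : State d M) {n : ℕ} (h : n % (d + 1) < d),
      ((y ⟨n % (d + 1), h⟩ : ℕ) : ℝ) + 1 ≤ M := fun y n h => by
    exact_mod_cast (y ⟨n % (d + 1), h⟩).isLt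
  by_cases h : m % (d + 1) < d <;> by_cases h' : m' % (d + 1) < d
  · rw [stateTime_ofNat_of_lt h, stateTime_ofNat_of_lt h', offset, offset, if_pos h, if_pos h']
    set a := (x ⟨m % (d + 1), h⟩ : ℕ)
    set b := (x' ⟨m' % (d + 1), h'⟩ : ℕ)
    by_cases hab : a = b
    · have hmm := one_le_abs_of_int_ne_zero (n := (m : ℤ) - m') (by omega)
      push_cast at hmm
      have : (a : ℝ) + 1 + m / (2 * N) - (b + 1 + m' / (2 * N)) = ((m : ℝ) - m') / (2 * N) := by
        rw [hab]; ring
      rw [this, abs_div, abs_of_pos (by linarith : (0 : ℝ) < 2 * N)]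
      gcongr
    · have hab' := one_le_abs_of_int_ne_zero (n := (a : ℤ) - b) (by omega)
      push_cast at hab'
      have h1 := hfrac m hm
      have h2 := hfrac m' hm'
      have h3 := hfrac0 m
      have h4 := hfrac0 m'
      rcases le_abs.1 hab' with h5 | h5
      · exact le_trans (by linarith) (le_abs_self _)
      · exact le_trans (by linarith) (neg_le_abs _)
  · rw [stateTime_ofNat_of_lt h, stateTime_ofNat_of_not_lt h', offset, offset, if_pos h,
      if_neg h']
    have h1 := hfrac m hm
    have h2 := hlet x h
    have h3 : (0 : ℝ) ≤ m' := m'.cast_nonneg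
    exact le_trans (by linarith [ht'.1]) (neg_le_abs _)
  · rw [stateTime_ofNat_of_not_lt h, stateTime_ofNat_of_lt h', offset, offset, if_neg h,
      if_pos h']
    have h1 := hfrac m' hm'
    have h2 := hlet x' h'
    have h3 : (0 : ℝ) ≤ m := m.cast_nonneg
    exact le_trans (by linarith [ht.1]) (le_abs_self _)
  · rw [stateTime_ofNat_of_not_lt h, stateTime_ofNat_of_not_lt h', offset, offset, if_neg h,
      if_neg h']
    have hmm := one_le_abs_of_int_ne_zero (n := (m : ℤ) - m') (by omega)
    push_cast at hmm
    rcases le_abs.1 hmm with h5 | h5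
    · exact le_trans (by linarith [ht.1, ht'.2]) (le_abs_self _)
    · exact le_trans (by linarith [ht.2, ht'.1]) (neg_le_abs _)

/-- Weight of the `m`-th matrix entry in the scalar that encodes `(x, t)`: the letters are the
digits in base `M`, the time is the fractional part, and later repetitions count nothing. -/
def digitWeight (d M m : ℕ) : ℝ := if m < d then (M : ℝ) ^ m else if m = d then 1 / 2 else 0

lemma digitWeight_nonneg (d M m : ℕ) : 0 ≤ digitWeight d M m := by
  unfold digitWeight
  split_ifs <;> positivity

lemma digitWeight_le (hM : 2 ≤ M) (m : ℕ) : digitWeight d M m ≤ (M : ℝ) ^ d := by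
  have hM' : (1 : ℝ) ≤ M := by exact_mod_cast (by omega : 1 ≤ M)
  have := one_le_pow₀ hM' (n := d)
  unfold digitWeight
  split_ifs with h
  · exact pow_le_pow_right₀ hM' h.le
  · linarith
  · linarith

/-- The part of the scalar code of `(x, t)` that is read off from token `k`. -/
def tokenDigits (d₀ k : ℕ) (x : State d M) (t : ℝ) : ℝ :=
  ∑ i : Fin d₀, digitWeight d M (i + d₀ * k) * stateTime x t (Fin.ofNat (d + 1) (i + d₀ * k))

lemma sum_tokens_eq_sum_range {L d₀ N : ℕ} (hL : L * d₀ = N) (F : ℕ → ℝ) :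
    ∑ k : Fin L, ∑ i : Fin d₀, F (i + d₀ * k) = ∑ m ∈ Finset.range N, F m := by
  subst hL
  rw [Finset.sum_range, ← finProdFinEquiv.sum_comp, Fintype.sum_prod_type]
  simp [finProdFinEquiv]

lemma tokenDigits_nonneg (hM : 2 ≤ M) (d₀ k : ℕ) (x : State d M) {t : ℝ}
    (ht : t ∈ Set.Icc (0 : ℝ) 1) : 0 ≤ tokenDigits d₀ k x t :=
  Finset.sum_nonneg fun _ _ => mul_nonneg (digitWeight_nonneg _ _ _) (stateTime_mem_Icc hM x ht _).1

lemma tokenDigits_mono (d₀ k : ℕ) (x : State d M) {t t' : ℝ} (h : t ≤ t') :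
    tokenDigits d₀ k x t ≤ tokenDigits d₀ k x t' := by
  refine Finset.sum_le_sum fun i _ => mul_le_mul_of_nonneg_left ?_ (digitWeight_nonneg _ _ _)
  by_cases hm : ((i : ℕ) + d₀ * k) % (d + 1) < d
  · rw [stateTime_ofNat_of_lt hm, stateTime_ofNat_of_lt hm]
  · rwa [stateTime_ofNat_of_not_lt hm, stateTime_ofNat_of_not_lt hm]

/-- The tokens together carry the index of the state, up to a constant, plus half of the time. -/
lemma sum_tokenDigits {L d₀ : ℕ} (hM : 2 ≤ M) (hL : L * d₀ = M ^ d) (x : State d M) (t : ℝ) :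
    ∑ k : Fin L, tokenDigits d₀ k x t =
      ((finFunctionFinEquiv x : ℕ) : ℝ) + ∑ m ∈ Finset.range d, (M : ℝ) ^ m + t / 2 := by
  have hd : d + 1 ≤ M ^ d := (Nat.lt_pow_self (by omega : 1 < M))
  have hmod : ∀ m : Fin d, (m : ℕ) % (d + 1) = m := fun m => Nat.mod_eq_of_lt (by omega)
  simp only [tokenDigits]
  rw [sum_tokens_eq_sum_range hL fun m =>
    digitWeight d M m * stateTime x t (Fin.ofNat (d + 1) m),
    ← Finset.sum_subset (Finset.range_mono hd), Finset.sum_range_succ]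
  · rw [stateTime_ofNat_of_not_lt (by simp), Finset.sum_range, Finset.sum_range,
      finFunctionFinEquiv_apply]
    push_cast
    rw [← Finset.sum_add_distrib]
    congr 1
    · refine Finset.sum_congr rfl fun m _ => ?_
      rw [stateTime_ofNat_of_lt (by rw [hmod]; exact m.isLt), digitWeight, if_pos m.isLt]
      simp only [hmod]
      ring
    · simp [digitWeight]
      ring
  · intro m _ hm
    have hm' : d < m := by
      by_contra h
      exact hm (Finset.mem_range.2 (by omega))
    simp [digitWeight, hm'.not_gt, hm'.ne']

/-- An upper bound for the scalar code of `(x, t)`. -/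
def digitBound (d M : ℕ) : ℝ := (M : ℝ) ^ d + ∑ m ∈ Finset.range d, (M : ℝ) ^ m + 1

lemma digitBound_pos (d M : ℕ) : 0 < digitBound d M := by
  unfold digitBound
  positivity

lemma sum_tokenDigits_le {L d₀ : ℕ} (hM : 2 ≤ M) (hL : L * d₀ = M ^ d) (x : State d M) {t : ℝ}
    (ht : t ∈ Set.Icc (0 : ℝ) 1) : ∑ k : Fin L, tokenDigits d₀ k x t ≤ digitBound d M := by
  rw [sum_tokenDigits hM hL, digitBound]
  have : ((finFunctionFinEquiv x : ℕ) : ℝ) ≤ (M : ℝ) ^ d := by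
    exact_mod_cast (finFunctionFinEquiv x).isLt.le
  linarith [ht.2]

/-- Weight of the sum over the tokens: large enough that different states remain apart when the
digits of a single token are added. -/
def poolWeight (d M : ℕ) : ℝ := 2 * digitBound d M + 2

/-- Distance between the codes of consecutive tokens. -/
def tokenGap (d M : ℕ) : ℝ := digitBound d M * (1 + poolWeight d M) + 1

lemma poolWeight_pos (d M : ℕ) : 0 < poolWeight d M := by
  linarith [digitBound_pos d M, show poolWeight d M = 2 * digitBound d M + 2 from rfl]

lemma tokenGap_pos (d M : ℕ) : 0 < tokenGap d M := by
  have := digitBound_pos d M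
  have := poolWeight_pos d M
  unfold tokenGap
  positivity

/-- The scalar that token `k` reads off from the input `(x, t)` before the tokens are pooled. -/
def tokenFeature (d₀ k : ℕ) (x : State d M) (t : ℝ) : ℝ :=
  d₀ * (tokenGap d M * k) + tokenDigits d₀ k x t

/-- The scalar that token `k` holds after pooling; it determines `k`, `x` and `t`. -/
def tokenCode (L d₀ k : ℕ) (x : State d M) (t : ℝ) : ℝ :=
  tokenFeature d₀ k x t + poolWeight d M * ∑ j : Fin L, tokenFeature d₀ j x t

lemma tokenCode_eq (L d₀ k : ℕ) (x : State d M) (t : ℝ) :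
    tokenCode L d₀ k x t = d₀ * tokenGap d M * k + tokenDigits d₀ k x t
      + poolWeight d M * ∑ j : Fin L, tokenDigits d₀ j x t
      + poolWeight d M * ∑ j : Fin L, d₀ * (tokenGap d M * (j : ℕ)) := by
  simp only [tokenCode, tokenFeature, Finset.sum_add_distrib]
  ring

lemma tokenDigits_le {L d₀ : ℕ} (hM : 2 ≤ M) (hL : L * d₀ = M ^ d)
    (k : Fin L) (x : State d M) {t : ℝ} (ht : t ∈ Set.Icc (0 : ℝ) 1) :
    tokenDigits d₀ k x t ≤ digitBound d M :=
  (Finset.single_le_sum (f := fun k : Fin L => tokenDigits d₀ k x t)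
    (fun _ _ => tokenDigits_nonneg hM _ _ _ ht) (Finset.mem_univ k)).trans
    (sum_tokenDigits_le hM hL x ht)

lemma tokenCode_separates_tokens {L d₀ : ℕ} (hM : 2 ≤ M) (hL : L * d₀ = M ^ d)
    {k k' : Fin L} (hk : k ≠ k') (x x' : State d M) {t t' : ℝ}
    (ht : t ∈ Set.Icc (0 : ℝ) 1) (ht' : t' ∈ Set.Icc (0 : ℝ) 1) :
    1 ≤ |tokenCode L d₀ k x t - tokenCode L d₀ k' x' t'| := by
  have hd₀ : (1 : ℝ) ≤ d₀ := by
    have : d₀ ≠ 0 := by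
      rintro rfl
      have : 0 < M ^ d := by positivity
      omega
    exact_mod_cast Nat.one_le_iff_ne_zero.2 this
  have hα := poolWeight_pos d M
  have hΛ := tokenGap_pos d M
  have h1 := tokenDigits_nonneg hM d₀ k x ht
  have h2 := tokenDigits_nonneg hM d₀ k' x' ht'
  have h3 := tokenDigits_le hM hL k x ht
  have h4 := tokenDigits_le hM hL k' x' ht'
  have h5 : 0 ≤ ∑ j : Fin L, tokenDigits d₀ j x t :=
    Finset.sum_nonneg fun _ _ => tokenDigits_nonneg hM _ _ _ ht
  have h6 : 0 ≤ ∑ j : Fin L, tokenDigits d₀ j x' t' :=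
    Finset.sum_nonneg fun _ _ => tokenDigits_nonneg hM _ _ _ ht'
  have h7 := mul_le_mul_of_nonneg_left (sum_tokenDigits_le hM hL x ht) hα.le
  have h8 := mul_le_mul_of_nonneg_left (sum_tokenDigits_le hM hL x' ht') hα.le
  have h5' := mul_nonneg hα.le h5
  have h6' := mul_nonneg hα.le h6
  have hkk := one_le_abs_of_int_ne_zero (n := ((k : ℕ) : ℤ) - (k' : ℕ)) (by
    have := Fin.val_ne_of_ne hk
    omega)
  push_cast at hkk
  have hΛd : tokenGap d M ≤ d₀ * tokenGap d M := le_mul_of_one_le_left hΛ.le hd₀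
  have hΛe : tokenGap d M = digitBound d M + poolWeight d M * digitBound d M + 1 := by
    unfold tokenGap
    ring
  rw [tokenCode_eq, tokenCode_eq]
  rcases le_abs.1 hkk with h | h
  · have := mul_le_mul_of_nonneg_left h (hΛ.le.trans hΛd)
    exact le_trans (by linarith) (le_abs_self _)
  · have := mul_le_mul_of_nonneg_left h (hΛ.le.trans hΛd)
    exact le_trans (by linarith) (neg_le_abs _)

lemma tokenCode_separates_states {L d₀ : ℕ} (hM : 2 ≤ M) (hL : L * d₀ = M ^ d)
    (k : Fin L) {x x' : State d M} (hx : x ≠ x') {t t' : ℝ}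
    (ht : t ∈ Set.Icc (0 : ℝ) 1) (ht' : t' ∈ Set.Icc (0 : ℝ) 1) :
    1 ≤ |tokenCode L d₀ k x t - tokenCode L d₀ k x' t'| := by
  have hα := poolWeight_pos d M
  have h1 := tokenDigits_nonneg hM d₀ k x ht
  have h2 := tokenDigits_nonneg hM d₀ k x' ht'
  have h3 := tokenDigits_le hM hL k x ht
  have h4 := tokenDigits_le hM hL k x' ht'
  have hαe : poolWeight d M * (1 / 2) = digitBound d M + 1 := by
    unfold poolWeight
    ring
  have hxx := one_le_abs_of_int_ne_zero
    (n := ((finFunctionFinEquiv x : ℕ) : ℤ) - (finFunctionFinEquiv x' : ℕ)) (by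
      have := Fin.val_ne_of_ne (finFunctionFinEquiv.injective.ne hx)
      omega)
  push_cast at hxx
  rw [tokenCode_eq, tokenCode_eq, sum_tokenDigits hM hL, sum_tokenDigits hM hL]
  rcases le_abs.1 hxx with h | h
  · have := mul_le_mul_of_nonneg_left (show (1 : ℝ) / 2 ≤ ((finFunctionFinEquiv x : ℕ) : ℝ)
      - (finFunctionFinEquiv x' : ℕ) + t / 2 - t' / 2 by linarith [ht.1, ht'.2]) hα.le
    exact le_trans (by linarith) (le_abs_self _)
  · have := mul_le_mul_of_nonneg_left (show (1 : ℝ) / 2 ≤ -(((finFunctionFinEquiv x : ℕ) : ℝ)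
      - (finFunctionFinEquiv x' : ℕ) + t / 2 - t' / 2) by linarith [ht.2, ht'.1]) hα.le
    exact le_trans (by linarith) (neg_le_abs _)

lemma abs_sub_le_tokenCode {L d₀ : ℕ} (hM : 2 ≤ M) (hL : L * d₀ = M ^ d)
    (k : Fin L) (x : State d M) (t t' : ℝ) :
    |t - t'| ≤ |tokenCode L d₀ k x t - tokenCode L d₀ k x t'| := by
  wlog h : t' ≤ t generalizing t t'
  · rw [abs_sub_comm, abs_sub_comm (tokenCode L d₀ k x t)]
    exact this t' t (le_of_not_ge h)
  have h1 := tokenDigits_mono d₀ k x h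
  have hα : 2 ≤ poolWeight d M := by
    have := digitBound_pos d M
    unfold poolWeight
    linarith
  have h2 := mul_le_mul_of_nonneg_right hα (sub_nonneg.2 h)
  rw [abs_of_nonneg (sub_nonneg.2 h)]
  refine le_trans ?_ (le_abs_self _)
  rw [tokenCode_eq, tokenCode_eq, sum_tokenDigits hM hL, sum_tokenDigits hM hL]
  linarith

lemma tokenCode_nonneg {L d₀ : ℕ} (hM : 2 ≤ M) (k : Fin L) (x : State d M) {t : ℝ} (ht : t ∈ Set.Icc (0 : ℝ) 1) :
    0 ≤ tokenCode L d₀ k x t := by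
  have hα := poolWeight_pos d M
  have hΛ := tokenGap_pos d M
  have h : ∀ j : ℕ, 0 ≤ tokenFeature d₀ j x t := fun j =>
    add_nonneg (by positivity) (tokenDigits_nonneg hM _ _ _ ht)
  exact add_nonneg (h k) (mul_nonneg hα.le (Finset.sum_nonneg fun j _ => h j))

/-- An upper bound for the codes of all tokens. -/
def codeBound (d M L d₀ : ℕ) : ℝ :=
  (d₀ * (tokenGap d M * L) + digitBound d M) * (1 + poolWeight d M * L)

lemma codeBound_pos (d M L d₀ : ℕ) : 0 < codeBound d M L d₀ := by
  have := tokenGap_pos d M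
  have := digitBound_pos d M
  have := poolWeight_pos d M
  unfold codeBound
  positivity

lemma abs_tokenCode_le {L d₀ : ℕ} (hM : 2 ≤ M) (hL : L * d₀ = M ^ d) (k : Fin L) (x : State d M)
    {t : ℝ} (ht : t ∈ Set.Icc (0 : ℝ) 1) : |tokenCode L d₀ k x t| ≤ codeBound d M L d₀ := by
  rw [abs_of_nonneg (tokenCode_nonneg hM k x ht)]
  have hΛ := tokenGap_pos d M
  have hα := poolWeight_pos d M
  have h : ∀ j : Fin L, tokenFeature d₀ j x t ≤ d₀ * (tokenGap d M * L) + digitBound d M :=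
    fun j => by
      refine add_le_add ?_ (tokenDigits_le hM hL j x ht)
      gcongr
      exact j.isLt.le
  have hs : ∑ j : Fin L, tokenFeature d₀ j x t ≤
      L * (d₀ * (tokenGap d M * L) + digitBound d M) := by
    have := Finset.sum_le_card_nsmul Finset.univ _ _ fun j _ => h j
    rwa [Finset.card_univ, Fintype.card_fin, nsmul_eq_mul] at this
  have := mul_le_mul_of_nonneg_left hs hα.le
  unfold tokenCode codeBound
  linarith [h k]

/-! ### The network -/

/-- The map computed by the network: the entries of each token are transformed by `ψ` and added up,
the resulting scalars are pooled over the tokens with weight `α`, and coordinate `i` of the output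
is the function `g i` of the scalar of the token. -/
def pooledNet {d₀ L : ℕ} (ψ : ℝ → ℝ) (g : Fin d₀ → ℝ → ℝ) (α : ℝ) (Z : Matrix (Fin d₀) (Fin L) ℝ) :
    Matrix (Fin d₀) (Fin L) ℝ :=
  Matrix.of fun i k => g i (∑ i', ψ (Z i' k) + α * ∑ j, ∑ i', ψ (Z i' j))

lemma exists_realizes_pooledNet {d₀ L : ℕ} {c : ParamBounds} {ov ff : ℝ} (hc : c.Admits ov ff)
    (hL : 0 < L) (hov : 0 < ov) (hff : 2 * (d₀ : ℝ) + 1 ≤ ff ^ 2) {α : ℝ} (hα : 0 ≤ α)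
    {κ : Type} [Fintype κ] (a b : κ → ℝ) (c₀ : ℝ)
    {κ' : Fin d₀ → Type} [∀ i, Fintype (κ' i)] (a' b' : ∀ i, κ' i → ℝ) (c₀' : Fin d₀ → ℝ) :
    ∃ h r : ℕ, 0 < h ∧ 0 < r ∧ Realizes (L := L) c h d₀ r
      (pooledNet (reluSum a b c₀) (fun i => reluSum (a' i) (b' i) (c₀' i)) α) := by
  obtain ⟨h, hh⟩ := exists_nat_gt (α * L * d₀ / ov)
  have hh0 : 0 < h := by
    have : (0 : ℝ) < h := lt_of_le_of_lt (by positivity) hh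
    exact_mod_cast this
  set r := Fintype.card (Fin d₀ × κ) + Fintype.card (Σ i, κ' i) + 2 * d₀ + 1 with hr
  refine ⟨h, r, hh0, by omega, ?_⟩
  have h₁ := realizes_reluLayer (L := L) (h := h) (s := d₀) (r := r) (ι := Fin d₀ × κ) hc
    (by omega) hff (fun j i => if i = j.1 then 1 else 0) (fun _ j => a j.2) (fun j => b j.2)
    (fun _ => d₀ * c₀)
  have h₂ := realizes_add_sum_tokens (r := r) hc hL hh0 hα ((div_le_iff₀ hov).1 hh.le)
  have h₃ := realizes_reluLayer (L := L) (h := h) (s := d₀) (r := r) (ι := Σ i, κ' i) hc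
    (by omega) hff (fun j i => if i = j.1 then 1 else 0)
    (fun i j => if i = j.1 then a' j.1 j.2 else 0) (fun j => b' j.1 j.2) c₀'
  convert h₃.comp (h₂.comp h₁) using 1
  funext Z
  ext i k
  simp [pooledNet, reluLayer, reluSum, Fintype.sum_prod_type, Fintype.sum_sigma,
    Finset.sum_add_distrib, Finset.sum_ite_eq]

section Bounds

variable {d₀ L : ℕ} {ψ : ℝ → ℝ} {g : Fin d₀ → ℝ → ℝ} {α K₁ K₂ : ℝ}

/-- Perturbing the scalar of every token by at most `η` perturbs the pooled scalars by a multiple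
of `η`. -/
lemma abs_pooled_sub_le (hα : 0 ≤ α) {v w : Fin L → ℝ} {η : ℝ} (h : ∀ k, |v k - w k| ≤ η)
    (k : Fin L) : |v k + α * ∑ j, v j - (w k + α * ∑ j, w j)| ≤ (1 + α * L) * η := by
  have hs : |∑ j, v j - ∑ j, w j| ≤ L * η := by
    rw [← Finset.sum_sub_distrib]
    refine (Finset.abs_sum_le_sum_abs _ _).trans ?_
    have := Finset.sum_le_card_nsmul Finset.univ _ _ fun j _ => h j
    rwa [Finset.card_univ, Fintype.card_fin, nsmul_eq_mul] at this
  calc |v k + α * ∑ j, v j - (w k + α * ∑ j, w j)|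
      = |(v k - w k) + α * (∑ j, v j - ∑ j, w j)| := by ring_nf
    _ ≤ |v k - w k| + |α * (∑ j, v j - ∑ j, w j)| := abs_add_le _ _
    _ = |v k - w k| + α * |∑ j, v j - ∑ j, w j| := by rw [abs_mul, abs_of_nonneg hα]
    _ ≤ η + α * (L * η) := add_le_add (h k) (mul_le_mul_of_nonneg_left hs hα)
    _ = _ := by ring

lemma frobNorm_pooledNet_sub_le (hα : 0 ≤ α) (hK₁ : 0 ≤ K₁) (hK₂ : 0 ≤ K₂)
    (hψ : ∀ x y, |ψ x - ψ y| ≤ K₁ * |x - y|) (hg : ∀ i x y, |g i x - g i y| ≤ K₂ * |x - y|)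
    (Z₁ Z₂ : Matrix (Fin d₀) (Fin L) ℝ) :
    frobNorm (pooledNet ψ g α Z₁ - pooledNet ψ g α Z₂) ≤
      d₀ * L * (K₂ * ((1 + α * L) * (d₀ * K₁))) * frobNorm (Z₁ - Z₂) := by
  have hF : 0 ≤ frobNorm (Z₁ - Z₂) := Real.sqrt_nonneg _
  rw [mul_assoc]
  refine frobNorm_le_of_forall_abs_le (by positivity) fun i k => (hg i _ _).trans ?_
  rw [mul_assoc]
  refine mul_le_mul_of_nonneg_left ?_ hK₂
  rw [mul_assoc]
  refine abs_pooled_sub_le hα (v := fun k => ∑ i', ψ (Z₁ i' k)) (w := fun k => ∑ i', ψ (Z₂ i' k))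
    (fun k => ?_) k
  rw [← Finset.sum_sub_distrib]
  refine (Finset.abs_sum_le_sum_abs _ _).trans ?_
  have : ∀ i ∈ Finset.univ, |ψ (Z₁ i k) - ψ (Z₂ i k)| ≤ K₁ * frobNorm (Z₁ - Z₂) := fun i _ =>
    (hψ _ _).trans (mul_le_mul_of_nonneg_left (abs_entry_le_frobNorm (Z₁ - Z₂) i k) hK₁)
  have := Finset.sum_le_card_nsmul Finset.univ _ _ this
  rwa [Finset.card_univ, Fintype.card_fin, nsmul_eq_mul, ← mul_assoc] at this

end Bounds

/-- Position encoding that adds to each entry the offset of its position. -/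
def positionEncoding (d M d₀ L : ℕ) : Matrix (Fin d₀) (Fin L) ℝ :=
  Matrix.of fun i k => offset d M (M ^ d) (i + d₀ * k)

lemma twoInftyNorm_positionEncoding_le {d₀ L : ℕ} (hd : 1 ≤ d) (hM : 2 ≤ M)
    (hL : L * d₀ = M ^ d) :
    twoInftyNorm (positionEncoding d M d₀ L)ᵀ ≤ d₀ * (4 * (M : ℝ) ^ d) := by
  refine Real.iSup_le (fun k => Real.sqrt_le_iff.2 ⟨by positivity, ?_⟩) (by positivity)
  have h1 : (M : ℝ) ≤ (M : ℝ) ^ d := by exact_mod_cast Nat.le_self_pow (by omega) M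
  have h2 : (2 : ℝ) ≤ M := by exact_mod_cast hM
  have h3 : ∀ i : Fin d₀, offset d M (M ^ d) (i + d₀ * k) ^ 2 ≤ (4 * (M : ℝ) ^ d) ^ 2 := fun i => by
    refine pow_le_pow_left₀ (offset_nonneg _ _ _ _) ?_ 2
    have hm : (i : ℕ) + d₀ * k < M ^ d := by
      rw [← hL]
      have := i.isLt
      have := k.isLt
      nlinarith
    have := offset_le (d := d) (M := M) hm
    push_cast at this
    linarith
  have h4 : (d₀ : ℝ) ≤ (d₀ : ℝ) ^ 2 := by exact_mod_cast Nat.le_self_pow two_ne_zero _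
  calc ∑ i : Fin d₀, offset d M (M ^ d) (i + d₀ * k) ^ 2 ≤ d₀ * (4 * (M : ℝ) ^ d) ^ 2 := by
        have := Finset.sum_le_card_nsmul Finset.univ _ _ fun i _ => h3 i
        rwa [Finset.card_univ, Fintype.card_fin, nsmul_eq_mul] at this
    _ ≤ (d₀ : ℝ) ^ 2 * (4 * (M : ℝ) ^ d) ^ 2 := by gcongr
    _ = _ := by ring

/-- An upper bound for the feature of a single entry. -/
def featureBound (d M : ℕ) : ℝ := tokenGap d M * (M : ℝ) ^ d + (M : ℝ) ^ d * M

/-- A Lipschitz constant for the features as functions of the shifted entries. -/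
def featureLipschitz (d M : ℕ) : ℝ := 2 * (M : ℝ) ^ d * featureBound d M + (M : ℝ) ^ d

lemma featureBound_nonneg (d M : ℕ) : 0 ≤ featureBound d M := by
  have := tokenGap_pos d M
  unfold featureBound
  positivity

lemma featureLipschitz_nonneg (d M : ℕ) : 0 ≤ featureLipschitz d M := by
  have := featureBound_nonneg d M
  unfold featureLipschitz
  positivity

/-- One function of the shifted entries, applied to all of them and summed over each token, yields
the token features up to any accuracy. -/
lemma exists_reluSum_tokenFeature {d₀ L : ℕ} (hM : 2 ≤ M) (hL : L * d₀ = M ^ d) {η : ℝ}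
    (hη : 0 < η) :
    ∃ (κ : Type) (_ : Fintype κ) (a b : κ → ℝ) (c₀ : ℝ),
      (∀ x y, |reluSum a b c₀ x - reluSum a b c₀ y| ≤ featureLipschitz d M * |x - y|) ∧
      ∀ (k : Fin L) (x : State d M), ∀ t ∈ Set.Icc (0 : ℝ) 1,
        |∑ i, reluSum a b c₀ ((reshapeIn d d₀ L (stateTime x t) + positionEncoding d M d₀ L) i k)
          - tokenFeature d₀ k x t| ≤ d₀ * η := by
  have hN : 0 < M ^ d := by positivity
  have hNR : ((M ^ d : ℕ) : ℝ) = (M : ℝ) ^ d := by push_cast; rfl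
  have hN' : (0 : ℝ) < (M : ℝ) ^ d := by positivity
  have hΛ := tokenGap_pos d M
  have hB := featureBound_nonneg d M
  have hd₀ : 0 < d₀ := Nat.pos_of_ne_zero (by rintro rfl; omega)
  let ι := Fin (M ^ d) × State d M × Set.Icc (0 : ℝ) 1
  have : Nonempty ι := ⟨⟨0, hN⟩, fun _ => ⟨0, by omega⟩, ⟨0, by simp⟩⟩
  let v : ι → ℝ := fun q => stateTime q.2.1 q.2.2 (Fin.ofNat (d + 1) q.1)
  let p : ι → ℝ := fun q => v q + offset d M (M ^ d) q.1
  let τ : ι → ℝ := fun q =>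
    tokenGap d M * ((q.1 / d₀ : ℕ) : ℝ) + digitWeight d M q.1 * v q
  have hv : ∀ q, v q ∈ Set.Icc (0 : ℝ) M := fun q => stateTime_mem_Icc hM _ q.2.2.2 _
  have hτ : ∀ q, 0 ≤ τ q ∧ τ q ≤ featureBound d M := fun q => by
    refine ⟨add_nonneg (by positivity) (mul_nonneg (digitWeight_nonneg _ _ _) (hv q).1),
      add_le_add (mul_le_mul_of_nonneg_left ?_ hΛ.le) ?_⟩
    · rw [← hNR]
      exact_mod_cast (Nat.div_le_self _ _).trans q.1.isLt.le
    · exact mul_le_mul (digitWeight_le hM _) (hv q).2 (hv q).1 hN'.le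
  have hlip : ∀ q q', |τ q - τ q'| ≤ featureLipschitz d M * |p q - p q'| := fun q q' => by
    by_cases hq : q.1 = q'.1
    · have h1 : τ q - τ q' = digitWeight d M q.1 * (p q - p q') := by
        simp only [τ, p, hq]
        ring
      rw [h1, abs_mul, abs_of_nonneg (digitWeight_nonneg _ _ _)]
      refine mul_le_mul_of_nonneg_right ((digitWeight_le hM _).trans ?_) (abs_nonneg _)
      exact le_add_of_nonneg_left (by positivity)
    · have h1 := offset_separates q.1.isLt q'.1.isLt (Fin.val_ne_of_ne hq) q.2.1 q'.2.1
        q.2.2.2 q'.2.2.2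
      have h2 : |τ q - τ q'| ≤ featureBound d M :=
        abs_sub_le_of_nonneg_of_le (hτ q).1 (hτ q).2 (hτ q').1 (hτ q').2
      rw [hNR] at h1
      have h3 : (0 : ℝ) ≤ |p q - p q'| := abs_nonneg _
      calc |τ q - τ q'| ≤ featureBound d M := h2
        _ = 2 * (M : ℝ) ^ d * featureBound d M * (1 / (2 * (M : ℝ) ^ d)) := by field_simp
        _ ≤ 2 * (M : ℝ) ^ d * featureBound d M * |p q - p q'| := by
            gcongr
        _ ≤ featureLipschitz d M * |p q - p q'| := by
            gcongr
            exact le_add_of_nonneg_right hN'.le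
  have hp : ∀ q, |p q| ≤ 2 * M + 2 + 2 * (M : ℝ) ^ d := fun q => by
    have h1 := offset_nonneg d M (M ^ d) q.1
    have h2 := offset_le (d := d) (M := M) q.1.isLt
    have h3 := hv q
    rw [hNR] at h2
    rw [abs_of_nonneg (add_nonneg h3.1 h1)]
    linarith [h3.2, show p q = v q + offset d M (M ^ d) q.1 from rfl]
  obtain ⟨κ, hκ, a, b, c₀, h1, -, h3⟩ := exists_reluSum_fit p τ (featureLipschitz_nonneg d M) hlip
    (by positivity) hp (fun q => by rw [abs_of_nonneg (hτ q).1]; exact (hτ q).2) hη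
  refine ⟨κ, hκ, a, b, c₀, h1, fun k x t ht => ?_⟩
  have hm : ∀ i : Fin d₀, (i : ℕ) + d₀ * k < M ^ d := fun i => by
    rw [← hL]
    have := i.isLt
    have := k.isLt
    nlinarith
  have hfeat : tokenFeature d₀ k x t = ∑ i : Fin d₀, τ (⟨i + d₀ * k, hm i⟩, x, ⟨t, ht⟩) := by
    have hdiv : ∀ i : Fin d₀, ((i : ℕ) + d₀ * k) / d₀ = k := fun i => by
      rw [Nat.add_mul_div_left _ _ hd₀, Nat.div_eq_of_lt i.isLt, zero_add]
    simp only [τ, v, hdiv, Finset.sum_add_distrib, tokenFeature, tokenDigits]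
    simp
  rw [hfeat, ← Finset.sum_sub_distrib]
  refine (Finset.abs_sum_le_sum_abs _ _).trans ?_
  have := Finset.sum_le_card_nsmul Finset.univ _ _ fun (i : Fin d₀) _ =>
    h3 (⟨i + d₀ * k, hm i⟩, x, ⟨t, ht⟩)
  rw [Finset.card_univ, Fintype.card_fin, nsmul_eq_mul] at this
  exact this

/-- The state at which a vector indexed by states is read off from row `i` and column `k`. -/
def entryState {d₀ L : ℕ} (hL : L * d₀ = M ^ d) (k : Fin L) (i : Fin d₀) : State d M :=
  finFunctionFinEquiv.symm (Fin.cast hL (finProdFinEquiv (k, i)))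

lemma norm_reshapeOut_sub_sq_le {d₀ L : ℕ} (hL : L * d₀ = M ^ d) {Z : Matrix (Fin d₀) (Fin L) ℝ}
    {w : EuclideanSpace ℝ (State d M)} {δ : ℝ} (h : ∀ i k, |Z i k - w (entryState hL k i)| ≤ δ) :
    ‖reshapeOut hL Z - w‖ ^ 2 ≤ (M : ℝ) ^ d * δ ^ 2 := by
  rw [EuclideanSpace.norm_sq_eq]
  have hy : ∀ y ∈ Finset.univ, ‖(reshapeOut hL Z - w) y‖ ^ 2 ≤ δ ^ 2 := fun y _ => by
    set q : Fin L × Fin d₀ := finProdFinEquiv.symm (Fin.cast hL.symm (finFunctionFinEquiv y))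
      with hq
    have hyq : entryState hL q.1 q.2 = y := by
      simp [entryState, hq, -finProdFinEquiv_symm_apply]
    have := h q.2 q.1
    rw [hyq] at this
    exact pow_le_pow_left₀ (norm_nonneg _) this 2
  have := Finset.sum_le_card_nsmul Finset.univ _ _ hy
  rw [Finset.card_univ, nsmul_eq_mul] at this
  simpa using this

/-- Every entry of the velocity is a Lipschitz function of the token codes, with a constant that
depends only on the bound and the Lipschitz constant of the velocity. -/
lemma abs_velocity_sub_le {d₀ L : ℕ} (hM : 2 ≤ M) (hL : L * d₀ = M ^ d) {Mu Lu : ℝ} (hMu : 0 ≤ Mu)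
    {u : State d M → ℝ → EuclideanSpace ℝ (State d M)}
    (hu : ∀ x, ∀ t ∈ Set.Icc (0 : ℝ) 1, ‖u x t‖ ≤ Mu)
    (hu' : ∀ x, ∀ t ∈ Set.Icc (0 : ℝ) 1, ∀ t' ∈ Set.Icc (0 : ℝ) 1,
      ‖u x t - u x t'‖ ≤ Lu * |t - t'|)
    (i : Fin d₀) (k k' : Fin L) (x x' : State d M) {t t' : ℝ}
    (ht : t ∈ Set.Icc (0 : ℝ) 1) (ht' : t' ∈ Set.Icc (0 : ℝ) 1) :
    |u x t (entryState hL k i) - u x' t' (entryState hL k' i)| ≤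
      (2 * Mu + |Lu|) * |tokenCode L d₀ k x t - tokenCode L d₀ k' x' t'| := by
  have hcoord : ∀ (w : EuclideanSpace ℝ (State d M)) (y : State d M), |w y| ≤ ‖w‖ := fun w y =>
    PiLp.norm_apply_le w y
  by_cases hkx : k = k' ∧ x = x'
  · obtain ⟨rfl, rfl⟩ := hkx
    have h1 := (hcoord (u x t - u x t') (entryState hL k i)).trans (hu' x t ht t' ht')
    have h2 := abs_sub_le_tokenCode hM hL k x t t'
    calc |u x t (entryState hL k i) - u x t' (entryState hL k i)| ≤ Lu * |t - t'| := h1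
      _ ≤ (2 * Mu + |Lu|) * |t - t'| := by
          refine mul_le_mul_of_nonneg_right ?_ (abs_nonneg _)
          linarith [le_abs_self Lu]
      _ ≤ _ := by gcongr
  · have h1 : 1 ≤ |tokenCode L d₀ k x t - tokenCode L d₀ k' x' t'| := by
      by_cases hk : k = k'
      · subst hk
        exact tokenCode_separates_states hM hL k (fun hx => hkx ⟨rfl, hx⟩) ht ht'
      · exact tokenCode_separates_tokens hM hL hk x x' ht ht'
    have h2 := (hcoord (u x t) (entryState hL k i)).trans (hu x t ht)
    have h3 := (hcoord (u x' t') (entryState hL k' i)).trans (hu x' t' ht')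
    calc |u x t (entryState hL k i) - u x' t' (entryState hL k' i)|
        ≤ |u x t (entryState hL k i)| + |u x' t' (entryState hL k' i)| := abs_sub _ _
      _ ≤ (2 * Mu + |Lu|) * 1 := by linarith [abs_nonneg Lu]
      _ ≤ _ := by gcongr

/-- Uniform approximation of velocities, to any accuracy, by networks whose output bound and
Lipschitz constant are independent of the accuracy. -/
lemma exists_pooledNet_approx {d₀ L : ℕ} (hM : 2 ≤ M) (hL : L * d₀ = M ^ d) {Mu Lu : ℝ}
    (hMu : 0 ≤ Mu) {u : State d M → ℝ → EuclideanSpace ℝ (State d M)}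
    (hu : ∀ x, ∀ t ∈ Set.Icc (0 : ℝ) 1, ‖u x t‖ ≤ Mu)
    (hu' : ∀ x, ∀ t ∈ Set.Icc (0 : ℝ) 1, ∀ t' ∈ Set.Icc (0 : ℝ) 1,
      ‖u x t - u x t'‖ ≤ Lu * |t - t'|)
    {c : ParamBounds} {ov ff : ℝ} (hc : c.Admits ov ff) (hov : 0 < ov)
    (hff : 2 * (d₀ : ℝ) + 1 ≤ ff ^ 2) {δ : ℝ} (hδ : 0 < δ) :
    ∃ (h r : ℕ) (f : Matrix (Fin d₀) (Fin L) ℝ → Matrix (Fin d₀) (Fin L) ℝ), 0 < h ∧ 0 < r ∧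
      Realizes c h d₀ r f ∧
      (∀ Z, frobNorm (f Z) ≤ d₀ * L * (Mu + (2 * Mu + |Lu|) * (4 * codeBound d M L d₀))) ∧
      (∀ Z₁ Z₂, frobNorm (f Z₁ - f Z₂) ≤ d₀ * L * ((2 * Mu + |Lu|) *
        ((1 + poolWeight d M * L) * (d₀ * featureLipschitz d M))) * frobNorm (Z₁ - Z₂)) ∧
      ∀ (x : State d M), ∀ t ∈ Set.Icc (0 : ℝ) 1, ∀ i k,
        |f (reshapeIn d d₀ L (stateTime x t) + positionEncoding d M d₀ L) i k
          - u x t (entryState hL k i)| ≤ δ := by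
  have hN : 0 < M ^ d := by positivity
  have hL0 : 0 < L := Nat.pos_of_ne_zero (by rintro rfl; omega)
  have hα := poolWeight_pos d M
  have hK : 0 ≤ 2 * Mu + |Lu| := by positivity
  set K := 2 * Mu + |Lu|
  set D := (1 + poolWeight d M * L) * d₀ with hD
  have hD0 : 0 ≤ D := by positivity
  -- The features are computed so accurately that the Lipschitz maps behind them lose only `δ / 2`.
  set η := δ / (2 * (K * D + 1)) with hη
  have hη0 : 0 < η := by positivity
  have hηδ : K * (D * η) ≤ δ / 2 := by
    rw [hη, ← mul_assoc, mul_div_assoc', div_le_div_iff₀ (by positivity) two_pos]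
    nlinarith [mul_nonneg hK hD0]
  obtain ⟨κ, hκ, a, b, c₀, hψ, hψτ⟩ := exists_reluSum_tokenFeature hM hL hη0
  let ι := Fin L × State d M × Set.Icc (0 : ℝ) 1
  have : Nonempty ι := ⟨⟨0, hL0⟩, fun _ => ⟨0, by omega⟩, ⟨0, by simp⟩⟩
  have hfit := fun i : Fin d₀ => exists_reluSum_fit (ι := ι)
    (fun q => tokenCode L d₀ q.1 q.2.1 q.2.2) (fun q => u q.2.1 q.2.2 (entryState hL q.1 i)) hK
    (fun q q' => abs_velocity_sub_le hM hL hMu hu hu' i _ _ _ _ q.2.2.2 q'.2.2.2)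
    (codeBound_pos d M L d₀) (fun q => abs_tokenCode_le hM hL _ _ q.2.2.2)
    (fun q => (PiLp.norm_apply_le (u q.2.1 q.2.2) _).trans (hu _ _ q.2.2.2)) (half_pos hδ)
  choose κ' hκ' a' b' c₀' hg hgB hgτ using hfit
  obtain ⟨h, r, hh, hr, hreal⟩ :=
    exists_realizes_pooledNet hc hL0 hov hff hα.le a b c₀ a' b' c₀'
  refine ⟨h, r, _, hh, hr, hreal, fun Z => ?_, fun Z₁ Z₂ => ?_, fun x t ht i k => ?_⟩
  · exact frobNorm_le_of_forall_abs_le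
      (by have := codeBound_pos d M L d₀; positivity) fun i k => hgB i _
  · exact frobNorm_pooledNet_sub_le hα.le (featureLipschitz_nonneg d M) hK hψ hg Z₁ Z₂
  · set Z := reshapeIn d d₀ L (stateTime x t) + positionEncoding d M d₀ L
    have h1 := abs_pooled_sub_le hα.le (v := fun k => ∑ i', reluSum a b c₀ (Z i' k))
      (w := fun k : Fin L => tokenFeature d₀ k x t) (fun k => hψτ k x t ht) k
    rw [← mul_assoc, ← hD] at h1
    have h2 := hgτ i (k, x, ⟨t, ht⟩)
    have h3 := (hg i (∑ i', reluSum a b c₀ (Z i' k) + poolWeight d M * ∑ j, ∑ i',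
      reluSum a b c₀ (Z i' j)) (tokenCode L d₀ k x t)).trans (mul_le_mul_of_nonneg_left h1 hK)
    calc _ ≤ _ := abs_sub_le _ (reluSum (a' i) (b' i) (c₀' i) (tokenCode L d₀ k x t)) _
      _ ≤ δ / 2 + δ / 2 := add_le_add (h3.trans hηδ) h2
      _ = δ := add_halves δ

end DFM

end

theorem mainTheorem7 :
    ∃ (C : ℝ) (k : ℕ), 0 < C ∧
      ∀ (d M d₀ L : ℕ), 1 ≤ d → 2 ≤ M → ∀ (hL : L * d₀ = M ^ d) (Mu Lu : ℝ),
      ∃ CT LT : ℝ,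
      ∀ (u : DFM.State d M → ℝ → EuclideanSpace ℝ (DFM.State d M))
        (p : ℝ → DFM.State d M → ℝ),
        (∀ x, ∀ t ∈ Set.Icc (0 : ℝ) 1, ‖u x t‖ ≤ Mu) →
        (∀ x, ∀ t ∈ Set.Icc (0 : ℝ) 1, ∀ t' ∈ Set.Icc (0 : ℝ) 1,
          ‖u x t - u x t'‖ ≤ Lu * |t - t'|) →
        (∀ t ∈ Set.Icc (0 : ℝ) 1, (∀ x, 0 ≤ p t x) ∧ ∑ x, p t x = 1) →
        ∀ ε : ℝ, 0 < ε → ε ≤ (M : ℝ) ^ (d + 1) * Mu →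
        ∃ (h s r : ℕ) (c : DFM.ParamBounds),
          0 < h ∧ 0 < s ∧ 0 < r ∧ c.CT = CT ∧ c.LT = LT ∧
          max c.CKQ c.CKQ2inf ≤ C * ((d : ℝ) * d₀) ^ k * Real.log M ^ k *
            ((M : ℝ) ^ (2 * d * d₀ + d + 4 * d₀ + 2) * (ε ^ (4 * d₀ + 2))⁻¹) ∧
          max c.COV c.COV2inf ≤ C * ((d : ℝ) * d₀) ^ k * ((M : ℝ) ^ (-(d : ℝ) / 2) * ε) ∧
          max c.CF c.CF2inf ≤ C * ((d : ℝ) * d₀) ^ k * ((M : ℝ) ^ (d + 1) * Mu * ε⁻¹) ∧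
          c.CE ≤ C * ((d : ℝ) * d₀) ^ k * (M : ℝ) ^ d ∧
          ∃ uθ ∈ DFM.transformerClass hL h s r c,
            ∀ t ∈ Set.Icc (0 : ℝ) 1,
              ∑ x, ‖uθ (DFM.stateTime x t) - u x t‖ ^ 2 * p t x ≤
                C * ε ^ ((4 : ℝ) / ((M : ℝ) ^ d + 2)) *
                  (M : ℝ) ^ ((4 * (M : ℝ) ^ d * d * d₀ + 13 * (M : ℝ) ^ d * d
                    + 8 * (M : ℝ) ^ d * d₀ + 12 * (M : ℝ) ^ d) / ((M : ℝ) ^ d + 2)) *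
                  Mu ^ (8 * (M : ℝ) ^ d / ((M : ℝ) ^ d + 2)) := by
  refine ⟨4, 1, by norm_num, fun d M d₀ L hd hM hL Mu Lu =>
    ⟨d₀ * L * (Mu + (2 * Mu + |Lu|) * (4 * DFM.codeBound d M L d₀)),
      d₀ * L * ((2 * Mu + |Lu|) *
        ((1 + DFM.poolWeight d M * L) * (d₀ * DFM.featureLipschitz d M))), ?_⟩⟩
  intro u p hu hu' hp ε hε hεM
  have hM0 : (0 : ℝ) < M := by positivity
  have hMd : (0 : ℝ) < (M : ℝ) ^ d := by positivity
  have hMu : 0 < Mu := pos_of_mul_pos_right (hε.trans_le hεM) (by positivity)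
  have hd₀ : 0 < d₀ := by
    have : 0 < M ^ d := by positivity
    exact Nat.pos_of_ne_zero (by rintro rfl; omega)
  have hd₀' : (1 : ℝ) ≤ d₀ := by exact_mod_cast hd₀
  have hd' : (1 : ℝ) ≤ d := by exact_mod_cast hd
  have hdd : (d₀ : ℝ) ≤ d * d₀ := le_mul_of_one_le_left (by positivity) hd'
  have hlog : 0 ≤ Real.log M := Real.log_nonneg (by exact_mod_cast (by omega : 1 ≤ M))
  set ρ := (4 : ℝ) * ε ^ ((4 : ℝ) / ((M : ℝ) ^ d + 2)) *
    (M : ℝ) ^ ((4 * (M : ℝ) ^ d * d * d₀ + 13 * (M : ℝ) ^ d * d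
      + 8 * (M : ℝ) ^ d * d₀ + 12 * (M : ℝ) ^ d) / ((M : ℝ) ^ d + 2)) *
    Mu ^ (8 * (M : ℝ) ^ d / ((M : ℝ) ^ d + 2)) with hρ
  have hρ0 : 0 < ρ := by positivity
  have hδ : 0 < Real.sqrt (ρ / (M : ℝ) ^ d) := Real.sqrt_pos.2 (by positivity)
  set ov : ℝ := (M : ℝ) ^ (-(d : ℝ) / 2) * ε with hov
  have hov0 : 0 < ov := by positivity
  let c : DFM.ParamBounds :=
    { CT := d₀ * L * (Mu + (2 * Mu + |Lu|) * (4 * DFM.codeBound d M L d₀))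
      CKQ2inf := 0, CKQ := 0, COV2inf := ov, COV := ov
      CE := d₀ * (4 * (M : ℝ) ^ d)
      CF2inf := 2 * d₀, CF := 2 * d₀
      LT := d₀ * L * ((2 * Mu + |Lu|) *
        ((1 + DFM.poolWeight d M * L) * (d₀ * DFM.featureLipschitz d M))) }
  have hc : c.Admits ov (2 * d₀) :=
    ⟨hov0.le, by positivity, le_rfl, le_rfl, le_rfl, le_rfl, le_rfl, le_rfl⟩
  obtain ⟨h, r, f, hh, hr, ⟨B, hB, hBc, hBf⟩, hfT, hfL, hfu⟩ :=
    DFM.exists_pooledNet_approx hM hL hMu.le hu hu' hc hov0 (by nlinarith) hδ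
  refine ⟨h, d₀, r, c, hh, hd₀, hr, rfl, rfl, ?_, ?_, ?_, ?_,
    fun v => DFM.reshapeOut hL
      (DFM.evalBlocks B (DFM.reshapeIn d d₀ L v + DFM.positionEncoding d M d₀ L)),
    ⟨B, DFM.positionEncoding d M d₀ L, hB, hBc, DFM.twoInftyNorm_positionEncoding_le hd hM hL,
      fun Z => by rw [hBf]; exact hfT Z, fun Z₁ Z₂ => by rw [hBf, hBf]; exact hfL Z₁ Z₂,
      fun v => rfl⟩, fun t ht => ?_⟩
  · rw [max_self]
    positivity
  · rw [max_self, pow_one]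
    exact le_mul_of_one_le_left hov0.le (by nlinarith)
  · -- The bound on `ε` makes the allowance for the feed-forward weights at least a constant.
    have h1 : 1 ≤ (M : ℝ) ^ (d + 1) * Mu * ε⁻¹ := by
      rw [← div_eq_mul_inv, one_le_div hε]
      exact hεM
    rw [max_self, pow_one]
    calc 2 * (d₀ : ℝ) ≤ 4 * (d * d₀) * 1 := by linarith
      _ ≤ _ := by gcongr
  · rw [pow_one]
    calc (d₀ : ℝ) * (4 * (M : ℝ) ^ d) = 4 * d₀ * (M : ℝ) ^ d := by ring
      _ ≤ _ := by gcongr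
  · have hx : ∀ x ∈ Finset.univ, ‖DFM.reshapeOut hL (DFM.evalBlocks B
        (DFM.reshapeIn d d₀ L (DFM.stateTime x t) + DFM.positionEncoding d M d₀ L)) - u x t‖ ^ 2
          * p t x ≤ ρ * p t x := fun x _ => by
      refine mul_le_mul_of_nonneg_right ?_ ((hp t ht).1 x)
      rw [hBf]
      refine (DFM.norm_reshapeOut_sub_sq_le hL (hfu x t ht)).trans_eq ?_
      rw [Real.sq_sqrt (by positivity), mul_div_cancel₀ _ hMd.ne']
    refine (Finset.sum_le_sum hx).trans_eq ?_
    rw [← Finset.mul_sum, (hp t ht).2, mul_one]
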